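/- Let $N_1$ be the connected, simply connected $7$-dimensional Lie group whose Lie algebra has a basis $z_1,z_2,z_3,\tau_1,\dots,\tau_4$ with $[\tau_1,\tau_2]=[\tau_3,\tau_4]=z_1$, $[\tau_1,\tau_3]=[\tau_4,\tau_2]=z_2$, $[\tau_1,\tau_4]=[\tau_2,\tau_3]=z_3$, all other brackets of basis vectors being zero (the quaternionic Heisenberg group). For $\lambda>0$ let $g=g_\lambda$ be the left-invariant Riemannian metric for which the left-invariant vector fields $\xi_i=z_i/\lambda$ $(i=1,2,3)$ and $\tau_1,\dots,\tau_4$ form an orthonormal frame. Let $\eta_i$ be the $1$-form dual to $\xi_i$, let $T^v$ be the vertical subbundle of the tangent bundle spanned by $\xi_1,\xi_2,\xi_3$, and let $T^h$ be its orthogonal complement. Let $\nabla^g$ be the Levi-Civita connection and let $\nabla$ be the metric connection with skew torsion $$T=\eta_1\wedge d\eta_1+\eta_2\wedge d\eta_2+\eta_3\wedge d\eta_3-4\lambda\,\eta_1\wedge\eta_2\wedge\eta_3,\qquad g(\nabla_XY,Z)=g(\nabla^g_XY,Z)+\tfrac12T(X,Y,Z).$$ Let $\Sigma$ be the real spinor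 bundle of rank $8$ of the unique spin structure of $N_1$, with the Clifford relation $X\cdot X=-|X|^2$, for the real $8$-dimensional Clifford module on which the volume element $\xi_1\cdot\xi_2\cdot\xi_3\cdot\tau_1\cdot\tau_2\cdot\tau_3\cdot\tau_4$ acts as the identity. The connections $\nabla^g$ and $\nabla$ induce connections on $\Sigma$, denoted by the same symbols, and $T$ acts on spinors by replacing wedge products by Clifford products. Then there is a nowhere vanishing smooth $\nabla$-parallel spinor field on $N_1$, unique up to a constant factor. Every nonzero smooth $\nabla$-parallel spinor field $\psi_0$ satisfies $$T\cdot\psi_0=-2\lambda\,\psi_0,\qquad T\cdot X\cdot\psi_0=6\lambda\,X\cdot\psi_0\ \text{ for }X\in T^v,\qquad T\cdot X\cdot\psi_0=-4\lambda\,X\cdot\psi_0\ \text{ for }X\in T^h,$$ and it is a generalized Killing spinor, i.e. $\nabla^g_X\psi_0=S(X)\cdot\psi_0$ for a smooth field $S$ of symmetric endomorphisms of the tangent bundle; more precisely, $$\nabla^g_X\psi_0=\frac{\lambda}{2}\,X\cdot\psi_0\ \text{ for }X\in T^v,\qquad \nabla^g_X\psi_0=-\frac{3\lambda}{4}\,X\cdot\psi_0\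 \text{ for }X\in T^h.$$ -/

import Mathlib

open scoped Manifold ContDiff

noncomputable section

namespace QHeis

/-! ### The group `N₁` -/

/-- Indices of the basis `z₁, z₂, z₃, τ₁, τ₂, τ₃, τ₄`: `inl 0, inl 1, inl 2` stand for the imaginary
quaternions `z₁, z₂, z₃ = i, j, k`, and `inr 0, …, inr 3` for the quaternions
`τ₁, τ₂, τ₃, τ₄ = 1, i, j, k`. -/
abbrev Idx : Type := Fin 3 ⊕ Fin 4

/-- The vector space `𝔫₁ = Im ℍ ⊕ ℍ`, in coordinates with respect to `z₁, z₂, z₃, τ₁, …, τ₄`. -/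
abbrev E : Type := Idx → ℝ

/-- The Lie bracket of `𝔫₁`: `[τ₁, τ₂] = [τ₃, τ₄] = z₁`, `[τ₁, τ₃] = [τ₄, τ₂] = z₂`,
`[τ₁, τ₄] = [τ₂, τ₃] = z₃`, all other brackets of basis vectors being zero. Equivalently, `z₁, z₂, z₃`
are central and `⟨[x, y], a⟩ = ⟨a x, y⟩` for quaternions `x, y` and `a` imaginary. -/
def bracket (v w : E) : E :=
  Sum.elim
    ![v (.inr 0) * w (.inr 1) - v (.inr 1) * w (.inr 0)
        + (v (.inr 2) * w (.inr 3) - v (.inr 3) * w (.inr 2)),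
      v (.inr 0) * w (.inr 2) - v (.inr 2) * w (.inr 0)
        + (v (.inr 3) * w (.inr 1) - v (.inr 1) * w (.inr 3)),
      v (.inr 0) * w (.inr 3) - v (.inr 3) * w (.inr 0)
        + (v (.inr 1) * w (.inr 2) - v (.inr 2) * w (.inr 1))]
    (fun _ => 0)

/-- The product `p + q + ½ [p, q]` on `𝔫₁`. -/
def mulE (p q : E) : E := p + q + (1 / 2 : ℝ) • bracket p q

theorem contDiff_mulE : ContDiff ℝ ∞ (fun r : E × E => mulE r.1 r.2) := by
  have h : ∀ a, ContDiff ℝ ∞ (fun r : E × E => r.1 a) := fun a =>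
    (contDiff_apply ℝ ℝ a).comp contDiff_fst
  have h' : ∀ a, ContDiff ℝ ∞ (fun r : E × E => r.2 a) := fun a =>
    (contDiff_apply ℝ ℝ a).comp contDiff_snd
  refine contDiff_pi.2 fun a => ?_
  rcases a with i | i <;> fin_cases i <;> simp [mulE, bracket] <;> fun_prop

theorem mulE_assoc (p q r : E) : mulE (mulE p q) r = mulE p (mulE q r) := by
  ext a
  rcases a with i | i <;> fin_cases i <;> simp [mulE, bracket] <;> ring

theorem zero_mulE (p : E) : mulE 0 p = p := by
  ext a
  rcases a with i | i <;> fin_cases i <;> simp [mulE, bracket]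

theorem neg_mulE (p : E) : mulE (-p) p = 0 := by
  ext a
  rcases a with i | i <;> fin_cases i <;> simp [mulE, bracket] <;> ring

/-- The connected, simply connected Lie group with Lie algebra `𝔫₁`, in exponential coordinates:
the space `𝔫₁` itself, with the product `p * q = p + q + ½ [p, q]`. -/
def N1 : Type := E

instance : TopologicalSpace N1 := inferInstanceAs (TopologicalSpace E)
instance : ChartedSpace E N1 := chartedSpaceSelf E
instance : IsManifold 𝓘(ℝ, E) ∞ N1 := inferInstanceAs (IsManifold 𝓘(ℝ, E) ∞ E)
instance : IsManifold 𝓘(ℝ, E) 2 N1 := inferInstanceAs (IsManifold 𝓘(ℝ, E) 2 E)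
instance : IsManifold 𝓘(ℝ, E) 1 N1 := inferInstanceAs (IsManifold 𝓘(ℝ, E) 1 E)

instance : Mul N1 := ⟨mulE⟩
instance : One N1 := ⟨(0 : E)⟩
instance : Inv N1 := ⟨fun p : E => -p⟩

instance : Group N1 := Group.ofLeftAxioms mulE_assoc zero_mulE neg_mulE

instance : LieGroup 𝓘(ℝ, E) ∞ N1 where
  contMDiff_mul := by
    have := contDiff_mulE.contMDiff
    rw [modelWithCornersSelf_prod, ← chartedSpaceSelf_prod] at this
    exact this
  contMDiff_inv := (contDiff_neg : ContDiff ℝ ∞ (fun p : E => -p)).contMDiff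

/-- The tangent space `T_p N₁`. -/
abbrev T (p : N1) : Type := TangentSpace 𝓘(ℝ, E) p

/-! ### The left-invariant metric `g_λ` and its left-invariant orthonormal frame -/

/-- The Maurer-Cartan form: the differential at `p` of left translation by `p⁻¹`. -/
def maurerCartan (p : N1) : T p →L[ℝ] E :=
  mfderiv 𝓘(ℝ, E) 𝓘(ℝ, E) (fun q : N1 => p⁻¹ * q) p

/-- The inner product on `𝔫₁` for which `z₁/λ, z₂/λ, z₃/λ, τ₁, …, τ₄` is orthonormal. -/
def innerOne (lam : ℝ) : E →L[ℝ] E →L[ℝ] ℝ :=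
  ∑ a : Idx, (Sum.elim (fun _ => lam ^ 2) (fun _ => 1) a : ℝ) •
    (ContinuousLinearMap.proj (R := ℝ) (φ := fun _ : Idx => ℝ) a).smulRight
      (ContinuousLinearMap.proj (R := ℝ) (φ := fun _ : Idx => ℝ) a)

/-- The left-invariant Riemannian metric `g_λ`. -/
def metric (lam : ℝ) (p : N1) : T p →L[ℝ] T p →L[ℝ] ℝ :=
  ContinuousLinearMap.precomp ℝ (maurerCartan p) ∘L innerOne lam ∘L maurerCartan p

/-- The vectors `ξ_i = z_i / λ` and `τ_l` of `𝔫₁`. -/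
def frameOne (lam : ℝ) (a : Idx) : E :=
  (Sum.elim (fun _ => lam⁻¹) (fun _ => 1) a : ℝ) • Pi.single a 1

/-- The left-invariant vector fields `ξ_i` and `τ_l`. -/
def frame (lam : ℝ) (a : Idx) (p : N1) : T p :=
  mulInvariantVectorField (I := 𝓘(ℝ, E)) (G := N1) (frameOne lam a) p

/-- The dual `1`-forms `η_i = g(ξ_i, ·)` and `θ_l = g(τ_l, ·)`. -/
def coframe (lam : ℝ) (a : Idx) (p : N1) : T p →L[ℝ] ℝ :=
  metric lam p (frame lam a p)

/-- The vertical subbundle `T^v`, spanned by `ξ₁, ξ₂, ξ₃`. -/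
def vertical (lam : ℝ) (p : N1) : Submodule ℝ (T p) :=
  Submodule.span ℝ (Set.range fun i : Fin 3 => frame lam (Sum.inl i) p)

/-- The horizontal subbundle `T^h`, the orthogonal complement of `T^v`. -/
def horizontal (lam : ℝ) (p : N1) : Submodule ℝ (T p) where
  carrier := {v | ∀ w ∈ vertical lam p, metric lam p w v = 0}
  add_mem' := fun hv hv' w hw => by rw [map_add, hv w hw, hv' w hw, add_zero]
  zero_mem' := fun w _ => map_zero _
  smul_mem' := fun c v hv w hw => by rw [map_smul, hv w hw, smul_zero]

/-! ### The torsion form -/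

/-- The Lie bracket of vector fields. -/
def vfBracket (X Y : Π p : N1, T p) : Π p : N1, T p := VectorField.mlieBracket 𝓘(ℝ, E) X Y

/-- The exterior derivative of a `1`-form: `dα(X, Y) = X(α(Y)) - Y(α(X)) - α([X, Y])`. -/
def extDerivOne (α : Π p : N1, T p →L[ℝ] ℝ) (X Y : Π p : N1, T p) (p : N1) : ℝ :=
  mvfderiv 𝓘(ℝ, E) (fun q => α q (Y q)) p (X p) - mvfderiv 𝓘(ℝ, E) (fun q => α q (X q)) p (Y p)
    - α p (vfBracket X Y p)

/-- The `3`-form `T = η₁ ∧ dη₁ + η₂ ∧ dη₂ + η₃ ∧ dη₃ - 4 λ η₁ ∧ η₂ ∧ η₃`, evaluated on vector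
fields. -/
def torsionForm (lam : ℝ) (X Y Z : Π p : N1, T p) (p : N1) : ℝ :=
  (∑ i : Fin 3, (coframe lam (Sum.inl i) p (X p) * extDerivOne (coframe lam (Sum.inl i)) Y Z p
    + coframe lam (Sum.inl i) p (Y p) * extDerivOne (coframe lam (Sum.inl i)) Z X p
    + coframe lam (Sum.inl i) p (Z p) * extDerivOne (coframe lam (Sum.inl i)) X Y p))
  - 4 * lam * Matrix.det (Matrix.of fun i j : Fin 3 =>
      coframe lam (Sum.inl i) p (![X p, Y p, Z p] j))

/-- The components of the torsion form in the orthonormal frame. -/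
def torsionCoeff (lam : ℝ) (a b c : Idx) (p : N1) : ℝ :=
  torsionForm lam (frame lam a) (frame lam b) (frame lam c) p

/-! ### Connections on the tangent bundle -/

/-- The Christoffel symbols `g(∇^g_{e_a} e_b, e_c)` of the Levi-Civita connection in the orthonormal
frame, given by the Koszul formula. -/
def christoffel (lam : ℝ) (a b c : Idx) (p : N1) : ℝ :=
  (1 / 2) * (metric lam p (vfBracket (frame lam a) (frame lam b) p) (frame lam c p)
    - metric lam p (vfBracket (frame lam b) (frame lam c) p) (frame lam a p)
    + metric lam p (vfBracket (frame lam c) (frame lam a) p) (frame lam b p))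

/-- The metric connection whose torsion `g(T(X, Y), Z)` is the `3`-form with components `t` in the
orthonormal frame, i.e. `g(∇_X Y, Z) = g(∇^g_X Y, Z) + ½ t(X, Y, Z)`. Like Mathlib's
`CovariantDerivative`, it takes the arguments in the order `Y, p, v` for `∇_v Y` at `p`. -/
def skewConnection (lam : ℝ) (t : Idx → Idx → Idx → N1 → ℝ) (Y : Π p : N1, T p) (p : N1) :
    T p →L[ℝ] T p :=
  ∑ c, (mvfderiv 𝓘(ℝ, E) (fun q => coframe lam c q (Y q)) p
    + ∑ a, ∑ b, ((christoffel lam a b c p + (1 / 2) * t a b c p) * coframe lam b p (Y p)) •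
        coframe lam a p).smulRight (frame lam c p)

/-- The Levi-Civita connection `∇^g` of `g_λ`. -/
def leviCivita (lam : ℝ) : (Π p : N1, T p) → Π p : N1, T p →L[ℝ] T p :=
  skewConnection lam fun _ _ _ _ => 0

/-- The canonical connection `∇`, the metric connection with skew torsion `T`. -/
def canonicalConnection (lam : ℝ) : (Π p : N1, T p) → Π p : N1, T p →L[ℝ] T p :=
  skewConnection lam (torsionCoeff lam)

/-! ### Consistency: the frame is orthonormal, the connections are metric and have the right torsion -/

theorem innerOne_apply (lam : ℝ) (v w : E) :
    innerOne lam v w = ∑ a : Idx, Sum.elim (fun _ => lam ^ 2) (fun _ => 1) a * (v a * w a) := by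
  simp [innerOne]

theorem innerOne_frameOne {lam : ℝ} (h : 0 < lam) (a : Idx) (w : E) :
    innerOne lam (frameOne lam a) w = Sum.elim (fun _ => lam) (fun _ => 1) a * w a := by
  have h' := h.ne'
  rcases a with i | i <;>
    simp [innerOne_apply, frameOne, Pi.single_apply]
  field_simp

theorem sum_frameOne {lam : ℝ} (h : 0 < lam) (w : E) :
    ∑ a, innerOne lam (frameOne lam a) w • frameOne lam a = w := by
  have h' := h.ne'
  ext b
  simp only [innerOne_frameOne h]
  rcases b with i | i <;> simp [frameOne, Pi.single_apply]
  field_simp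

/-- The differential of left translation by `p`. -/
def leftCLM (p : E) : E →L[ℝ] E :=
  LinearMap.toContinuousLinearMap
    { toFun := fun v => v + (1 / 2 : ℝ) • bracket p v
      map_add' := fun v w => by
        ext a
        rcases a with i | i <;> fin_cases i <;> simp [bracket] <;> ring
      map_smul' := fun c v => by
        ext a
        rcases a with i | i <;> fin_cases i <;> simp [bracket] <;> ring }

theorem hasFDerivAt_mulE (p q : E) : HasFDerivAt (mulE p) (leftCLM p) q := by
  have e : mulE p = fun q => p + leftCLM p q := by
    funext q
    exact add_assoc p q ((1 / 2 : ℝ) • bracket p q)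
  rw [e]
  exact (leftCLM p).hasFDerivAt.const_add _

theorem hasMFDerivAt_left (p q : N1) :
    HasMFDerivAt 𝓘(ℝ, E) 𝓘(ℝ, E) (fun q : N1 => p * q) q (leftCLM p) :=
  (hasFDerivAt_mulE p q).hasMFDerivAt

theorem maurerCartan_eq (p : N1) : maurerCartan p = leftCLM (p⁻¹ : N1) :=
  (hasMFDerivAt_left p⁻¹ p).mfderiv

theorem frame_eq (lam : ℝ) (a : Idx) (p : N1) : frame lam a p = leftCLM p (frameOne lam a) := by
  change mfderiv 𝓘(ℝ, E) 𝓘(ℝ, E) (fun q : N1 => p * q) 1 (frameOne lam a) = _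
  rw [(hasMFDerivAt_left p 1).mfderiv]
  rfl

theorem leftCLM_neg (p v : E) : leftCLM (-p) (leftCLM p v) = v := by
  ext a
  rcases a with i | i <;> fin_cases i <;> simp [leftCLM, bracket] <;> ring

theorem leftCLM_neg' (p v : E) : leftCLM p (leftCLM (-p) v) = v := by
  simpa using leftCLM_neg (-p) v

theorem maurerCartan_frame (lam : ℝ) (a : Idx) (p : N1) :
    maurerCartan p (frame lam a p) = frameOne lam a := by
  rw [maurerCartan_eq, frame_eq]
  exact leftCLM_neg _ _

theorem coframe_apply {lam : ℝ} (h : 0 < lam) (a : Idx) (p : N1) (v : T p) :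
    coframe lam a p v = Sum.elim (fun _ => lam) (fun _ => 1) a * maurerCartan p v a := by
  rw [← innerOne_frameOne h, ← maurerCartan_frame lam a p]
  rfl

theorem sum_coframe {lam : ℝ} (h : 0 < lam) (p : N1) (v : T p) :
    ∑ a, coframe lam a p v • frame lam a p = v := by
  have e : ∀ a, coframe lam a p v = innerOne lam (frameOne lam a) (leftCLM (p⁻¹ : N1) v) := fun a => by
    rw [← maurerCartan_frame lam a p, ← maurerCartan_eq]
    rfl
  simp only [e, frame_eq]
  have := congrArg (leftCLM p) (sum_frameOne h (leftCLM (p⁻¹ : N1) v))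
  rw [map_sum] at this
  simp only [map_smul] at this
  exact this.trans (leftCLM_neg' p v)

theorem coframe_frame {lam : ℝ} (h : 0 < lam) (p : N1) (a b : Idx) :
    coframe lam a p (frame lam b p) = if a = b then 1 else 0 := by
  have h' := h.ne'
  rw [coframe_apply h, maurerCartan_frame]
  rcases a with i | i <;> rcases b with j | j <;> simp [frameOne, Pi.single_apply, h']

theorem metric_eq_sum {lam : ℝ} (h : 0 < lam) (p : N1) (v w : T p) :
    metric lam p v w = ∑ a, coframe lam a p v * coframe lam a p w := by
  conv_lhs => rw [← sum_coframe h p v]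
  simp [map_sum, coframe]

theorem differentiableAt_leftCLM_neg {Y : E → E} {p : E} (h : DifferentiableAt ℝ Y p) (a : Idx) :
    DifferentiableAt ℝ (fun q => leftCLM (-q) (Y q) a) p := by
  rcases a with i | i <;> fin_cases i <;> simp [leftCLM, bracket] <;> fun_prop

theorem mdifferentiableAt_frame (lam : ℝ) (a : Idx) (p : N1) :
    MDifferentiableAt 𝓘(ℝ, E) (𝓘(ℝ, E).prod 𝓘(ℝ, E))
      (fun q => (⟨q, frame lam a q⟩ : TangentBundle 𝓘(ℝ, E) N1)) p :=
  haveI : LieGroup 𝓘(ℝ, E) (minSmoothness ℝ 3) N1 := LieGroup.of_le (n := ∞) (by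
    simp only [minSmoothness_of_isRCLikeNormedField]; exact WithTop.coe_le_coe.2 le_top)
  mdifferentiableAt_mulInvariantVectorField (G := N1) (I := 𝓘(ℝ, E)) (frameOne lam a)

theorem mdifferentiableAt_coframe {lam : ℝ} (hl : 0 < lam) (a : Idx)
    {Y : Π p : N1, T p} {p : N1} (hY : MDifferentiableAt 𝓘(ℝ, E) (𝓘(ℝ, E).prod 𝓘(ℝ, E))
      (fun q => (⟨q, Y q⟩ : TangentBundle 𝓘(ℝ, E) N1)) p) :
    MDifferentiableAt 𝓘(ℝ, E) 𝓘(ℝ, ℝ) (fun q => coframe lam a q (Y q)) p := by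
  have h : DifferentiableAt ℝ (fun q : E => (Y q : E)) p :=
    MDifferentiableAt.differentiableAt (((contMDiff_snd_tangentBundle_modelSpace (n := 1) E
      𝓘(ℝ, E)).contMDiffAt.mdifferentiableAt one_ne_zero).comp (M := E) p hY)
  have e : (fun q => coframe lam a q (Y q)) =
      fun q : E => Sum.elim (fun _ => lam) (fun _ => 1) a * leftCLM (-q) (Y q) a := by
    funext q
    rw [coframe_apply hl, maurerCartan_eq]
    rfl
  rw [e]
  exact ((differentiableAt_leftCLM_neg h a).const_mul _).mdifferentiableAt

/-- `skewConnection` is a connection. -/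
theorem isCovariantDerivativeOn_skewConnection {lam : ℝ} (h : 0 < lam)
    (t : Idx → Idx → Idx → N1 → ℝ) :
    IsCovariantDerivativeOn E (skewConnection lam t) where
  add {Y Z p} hY hZ _ := by
    have e : ∀ c, mvfderiv 𝓘(ℝ, E) (fun q => coframe lam c q ((Y + Z) q)) p
        = mvfderiv 𝓘(ℝ, E) (fun q => coframe lam c q (Y q)) p
          + mvfderiv 𝓘(ℝ, E) (fun q => coframe lam c q (Z q)) p := fun c => by
      rw [← mvfderiv_add (mdifferentiableAt_coframe h c hY) (mdifferentiableAt_coframe h c hZ)]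
      congr 1; ext q; exact map_add _ _ _
    ext v
    simp only [skewConnection, _root_.sum_apply, _root_.add_apply, e,
      ContinuousLinearMap.smulRight_apply, _root_.smul_apply,
      ← Finset.sum_add_distrib, ← add_smul, smul_eq_mul]
    refine Finset.sum_congr rfl fun c _ => ?_
    congr 1
    simp only [Finset.sum_add_distrib, Pi.add_apply, map_add, mul_add, add_mul]
    ring
  leibniz {Y f p} hY hf _ := by
    have e : ∀ c, mvfderiv 𝓘(ℝ, E) (fun q => coframe lam c q ((f • Y) q)) p
        = f p • mvfderiv 𝓘(ℝ, E) (fun q => coframe lam c q (Y q)) p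
          + coframe lam c p (Y p) • mvfderiv 𝓘(ℝ, E) f p := fun c => by
      rw [← mvfderiv_mul hf (mdifferentiableAt_coframe h c hY)]
      congr 1; ext q; exact (coframe lam c q).map_smul _ _
    ext v
    conv_rhs => rw [← sum_coframe h p (Y p)]
    simp only [skewConnection, _root_.sum_apply, _root_.add_apply, e,
      ContinuousLinearMap.smulRight_apply, _root_.smul_apply,
      smul_eq_mul, Finset.smul_sum, ← Finset.sum_add_distrib, smul_smul, ← add_smul]
    refine Finset.sum_congr rfl fun c _ => ?_
    congr 1
    simp only [mul_add, Finset.mul_sum, Pi.smul_apply', map_smul, smul_eq_mul]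
    have : ∀ a b, (christoffel lam a b c p + 1 / 2 * t a b c p) * (f p * coframe lam b p (Y p)) *
        coframe lam a p v = f p * ((christoffel lam a b c p + 1 / 2 * t a b c p) *
          coframe lam b p (Y p) * coframe lam a p v) := fun a b => by ring
    simp only [this]
    ring

theorem vfBracket_swap (X Y : Π p : N1, T p) (p : N1) : vfBracket X Y p = -vfBracket Y X p :=
  VectorField.mlieBracket_swap_apply

theorem coframe_skewConnection {lam : ℝ} (h : 0 < lam) (t : Idx → Idx → Idx → N1 → ℝ)
    (Y : Π p : N1, T p) (p : N1) (v : T p) (c : Idx) :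
    coframe lam c p (skewConnection lam t Y p v) =
      mvfderiv 𝓘(ℝ, E) (fun q => coframe lam c q (Y q)) p v
        + ∑ a, ∑ b, (christoffel lam a b c p + (1 / 2) * t a b c p) * coframe lam b p (Y p) *
            coframe lam a p v := by
  simp only [skewConnection, _root_.sum_apply, ContinuousLinearMap.smulRight_apply, map_sum,
    map_smul, coframe_frame h, smul_eq_mul, _root_.add_apply, _root_.smul_apply]
  simp

theorem christoffel_skew (lam : ℝ) (a b c : Idx) (p : N1) :
    christoffel lam a c b p = -christoffel lam a b c p := by
  simp only [christoffel, vfBracket_swap (frame lam a) (frame lam c),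
    vfBracket_swap (frame lam c) (frame lam b), vfBracket_swap (frame lam b) (frame lam a),
    map_neg, _root_.neg_apply]
  ring

theorem christoffel_sub (lam : ℝ) (a b c : Idx) (p : N1) :
    christoffel lam a b c p - christoffel lam b a c p =
      metric lam p (vfBracket (frame lam a) (frame lam b) p) (frame lam c p) := by
  simp only [christoffel, vfBracket_swap (frame lam a) (frame lam c),
    vfBracket_swap (frame lam c) (frame lam b), vfBracket_swap (frame lam b) (frame lam a),
    map_neg, _root_.neg_apply]
  ring

theorem metric_symm (lam : ℝ) (p : N1) (v w : T p) : metric lam p v w = metric lam p w v := by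
  change innerOne lam _ _ = innerOne lam _ _
  simp only [innerOne_apply, mul_comm]

/-- `skewConnection` is metric, if `t` is skew. -/
theorem metric_skewConnection {lam : ℝ} (h : 0 < lam) {t : Idx → Idx → Idx → N1 → ℝ}
    (ht : ∀ a b c p, t a c b p = -t a b c p) {Y Z : Π p : N1, T p} {p : N1}
    (hY : MDifferentiableAt 𝓘(ℝ, E) (𝓘(ℝ, E).prod 𝓘(ℝ, E))
      (fun q => (⟨q, Y q⟩ : TangentBundle 𝓘(ℝ, E) N1)) p)
    (hZ : MDifferentiableAt 𝓘(ℝ, E) (𝓘(ℝ, E).prod 𝓘(ℝ, E))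
      (fun q => (⟨q, Z q⟩ : TangentBundle 𝓘(ℝ, E) N1)) p) (v : T p) :
    mvfderiv 𝓘(ℝ, E) (fun q => metric lam q (Y q) (Z q)) p v =
      metric lam p (skewConnection lam t Y p v) (Z p) +
        metric lam p (Y p) (skewConnection lam t Z p v) := by
  have e : (fun q => metric lam q (Y q) (Z q)) =
      fun q => ∑ c, coframe lam c q (Y q) * coframe lam c q (Z q) := by
    funext q; exact metric_eq_sum h q _ _
  have e2 : mvfderiv 𝓘(ℝ, E) (fun q => ∑ c, coframe lam c q (Y q) * coframe lam c q (Z q)) p v =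
      ∑ c, (coframe lam c p (Y p) * mvfderiv 𝓘(ℝ, E) (fun q => coframe lam c q (Z q)) p v +
        coframe lam c p (Z p) * mvfderiv 𝓘(ℝ, E) (fun q => coframe lam c q (Y q)) p v) := by
    have hs : ∀ s : Finset Idx, MDifferentiableAt 𝓘(ℝ, E) 𝓘(ℝ, ℝ)
          (fun q => ∑ c ∈ s, coframe lam c q (Y q) * coframe lam c q (Z q)) p ∧
        mvfderiv 𝓘(ℝ, E) (fun q => ∑ c ∈ s, coframe lam c q (Y q) * coframe lam c q (Z q)) p v =
      ∑ c ∈ s, (coframe lam c p (Y p) * mvfderiv 𝓘(ℝ, E) (fun q => coframe lam c q (Z q)) p v +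
        coframe lam c p (Z p) * mvfderiv 𝓘(ℝ, E) (fun q => coframe lam c q (Y q)) p v) := by
      intro s
      induction s using Finset.induction_on with
      | empty =>
        simp only [Finset.sum_empty]
        exact ⟨mdifferentiableAt_const, by rw [mvfderiv_const]; rfl⟩
      | insert c s hc ih =>
        have hm := (mdifferentiableAt_coframe h c hY).mul (mdifferentiableAt_coframe h c hZ)
        simp only [Finset.sum_insert hc]
        refine ⟨hm.add ih.1, ?_⟩
        rw [← ih.2]
        have := mvfderiv_add hm ih.1
        have h2 := mvfderiv_mul (mdifferentiableAt_coframe h c hY) (mdifferentiableAt_coframe h c hZ)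
        rw [h2] at this
        exact congrArg (fun L => L v) this
    exact (hs Finset.univ).2
  rw [e, e2, metric_eq_sum h, metric_eq_sum h]
  simp only [coframe_skewConnection h, add_mul, mul_add, Finset.sum_add_distrib]
  have key : ∑ c, (∑ a, ∑ b, (christoffel lam a b c p + (1 / 2) * t a b c p) *
      coframe lam b p (Y p) * coframe lam a p v) * coframe lam c p (Z p) +
      ∑ c, coframe lam c p (Y p) * (∑ a, ∑ b, (christoffel lam a b c p + (1 / 2) * t a b c p) *
      coframe lam b p (Z p) * coframe lam a p v) = 0 := by
    simp only [Finset.sum_mul, Finset.mul_sum]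
    rw [Finset.sum_comm, Finset.sum_comm (γ := Idx) (f := fun c a => ∑ b, coframe lam c p (Y p) * _),
      ← Finset.sum_add_distrib]
    refine Finset.sum_eq_zero fun a _ => ?_
    rw [Finset.sum_comm, ← Finset.sum_add_distrib]
    refine Finset.sum_eq_zero fun b _ => ?_
    rw [← Finset.sum_add_distrib]
    refine Finset.sum_eq_zero fun c _ => ?_
    rw [christoffel_skew lam a b c, ht a b c]
    ring
  simp only [add_mul, mul_add, Finset.sum_add_distrib] at key
  have c1 : ∀ x : Idx, coframe lam x p (Z p) * mvfderiv 𝓘(ℝ, E) (fun q => coframe lam x q (Y q)) p v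
    = mvfderiv 𝓘(ℝ, E) (fun q => coframe lam x q (Y q)) p v * coframe lam x p (Z p) :=
    fun x => mul_comm _ _
  simp only [c1]
  linarith

/-- The torsion of `skewConnection` is `t`, if `t` is skew. -/
theorem torsion_skewConnection {lam : ℝ} (h : 0 < lam) {t : Idx → Idx → Idx → N1 → ℝ}
    (ht : ∀ a b c p, t b a c p = -t a b c p) {X Y : Π p : N1, T p} {p : N1}
    (hX : MDifferentiableAt 𝓘(ℝ, E) (𝓘(ℝ, E).prod 𝓘(ℝ, E))
      (fun q => (⟨q, X q⟩ : TangentBundle 𝓘(ℝ, E) N1)) p)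
    (hY : MDifferentiableAt 𝓘(ℝ, E) (𝓘(ℝ, E).prod 𝓘(ℝ, E))
      (fun q => (⟨q, Y q⟩ : TangentBundle 𝓘(ℝ, E) N1)) p) (c : Idx) :
    coframe lam c p (skewConnection lam t Y p (X p) - skewConnection lam t X p (Y p)
        - vfBracket X Y p) =
      ∑ a, ∑ b, t a b c p * coframe lam a p (X p) * coframe lam b p (Y p) := by
  have hcov := isCovariantDerivativeOn_skewConnection h t
  have hT : ∀ {X Y : Π p : N1, T p}, MDifferentiableAt 𝓘(ℝ, E) (𝓘(ℝ, E).prod 𝓘(ℝ, E))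
      (fun q => (⟨q, X q⟩ : TangentBundle 𝓘(ℝ, E) N1)) p →
      MDifferentiableAt 𝓘(ℝ, E) (𝓘(ℝ, E).prod 𝓘(ℝ, E))
      (fun q => (⟨q, Y q⟩ : TangentBundle 𝓘(ℝ, E) N1)) p →
      hcov.torsion p (X p) (Y p) = skewConnection lam t Y p (X p) - skewConnection lam t X p (Y p)
        - vfBracket X Y p := fun hX hY => hcov.torsion_apply hX hY
  rw [← hT hX hY]
  conv_lhs => rw [← sum_coframe h p (X p), ← sum_coframe h p (Y p)]
  simp only [map_sum, map_smul, _root_.sum_apply, _root_.smul_apply,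
    hT (mdifferentiableAt_frame lam _ p) (mdifferentiableAt_frame lam _ p)]
  have key : ∀ a b, coframe lam c p (skewConnection lam t (frame lam b) p (frame lam a p) -
      skewConnection lam t (frame lam a) p (frame lam b p) -
        vfBracket (frame lam a) (frame lam b) p) = t a b c p := by
    intro a b
    have hd : ∀ (a b : Idx), mvfderiv 𝓘(ℝ, E) (fun q => coframe lam a q (frame lam b q)) p = 0 := by
      intro a b
      simp only [coframe_frame h]
      exact mvfderiv_const _
    have e := christoffel_sub lam a b c p
    rw [metric_symm] at e
    change _ = coframe lam c p _ at e
    rw [map_sub, map_sub, coframe_skewConnection h, coframe_skewConnection h, hd, hd, ← e]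
    have hs : ∀ (f : Idx → Idx → ℝ) (a b : Idx), ∑ a', ∑ b', f a' b' * (if b' = b then 1 else 0) *
        (if a' = a then 1 else 0) = f a b := fun f a b => by
      rw [Finset.sum_eq_single a (fun x _ hx => by simp [hx]) (by simp)]
      simp
    simp only [coframe_frame h, _root_.zero_apply, zero_add]
    rw [hs (fun a b => christoffel lam a b c p + 1 / 2 * t a b c p) a b,
      hs (fun a b => christoffel lam a b c p + 1 / 2 * t a b c p) b a]
    have := ht a b c p
    linarith
  simp only [key, smul_eq_mul, Finset.mul_sum]
  rw [Finset.sum_comm]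
  refine Finset.sum_congr rfl fun a _ => Finset.sum_congr rfl fun b _ => ?_
  ring

theorem extDerivOne_swap (α : Π p : N1, T p →L[ℝ] ℝ) (X Y : Π p : N1, T p) (p : N1) :
    extDerivOne α Y X p = -extDerivOne α X Y p := by
  simp only [extDerivOne, vfBracket_swap Y X, map_neg]
  ring

theorem torsionForm_swap_left (lam : ℝ) (X Y Z : Π p : N1, T p) (p : N1) :
    torsionForm lam Y X Z p = -torsionForm lam X Y Z p := by
  simp only [torsionForm, Matrix.det_fin_three, Fin.sum_univ_three, Matrix.of_apply,
    extDerivOne_swap _ Y X, extDerivOne_swap _ X Z, extDerivOne_swap _ Z Y]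
  simp
  ring

theorem torsionForm_swap_right (lam : ℝ) (X Y Z : Π p : N1, T p) (p : N1) :
    torsionForm lam X Z Y p = -torsionForm lam X Y Z p := by
  simp only [torsionForm, Matrix.det_fin_three, Fin.sum_univ_three, Matrix.of_apply,
    extDerivOne_swap _ Y X, extDerivOne_swap _ X Z, extDerivOne_swap _ Z Y]
  simp
  ring

theorem torsionCoeff_swap_left (lam : ℝ) (a b c : Idx) (p : N1) :
    torsionCoeff lam b a c p = -torsionCoeff lam a b c p :=
  torsionForm_swap_left lam (frame lam a) (frame lam b) (frame lam c) p

theorem torsionCoeff_swap_right (lam : ℝ) (a b c : Idx) (p : N1) :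
    torsionCoeff lam a c b p = -torsionCoeff lam a b c p :=
  torsionForm_swap_right lam (frame lam a) (frame lam b) (frame lam c) p

/-- The Levi-Civita connection is metric. -/
theorem leviCivita_metric {lam : ℝ} (h : 0 < lam) {Y Z : Π p : N1, T p} {p : N1}
    (hY : MDifferentiableAt 𝓘(ℝ, E) (𝓘(ℝ, E).prod 𝓘(ℝ, E))
      (fun q => (⟨q, Y q⟩ : TangentBundle 𝓘(ℝ, E) N1)) p)
    (hZ : MDifferentiableAt 𝓘(ℝ, E) (𝓘(ℝ, E).prod 𝓘(ℝ, E))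
      (fun q => (⟨q, Z q⟩ : TangentBundle 𝓘(ℝ, E) N1)) p) (v : T p) :
    mvfderiv 𝓘(ℝ, E) (fun q => metric lam q (Y q) (Z q)) p v =
      metric lam p (leviCivita lam Y p v) (Z p) + metric lam p (Y p) (leviCivita lam Z p v) :=
  metric_skewConnection (t := fun _ _ _ _ => 0) h (by simp) hY hZ v

/-- The Levi-Civita connection is torsion-free. -/
theorem leviCivita_torsion {lam : ℝ} (h : 0 < lam) {X Y : Π p : N1, T p} {p : N1}
    (hX : MDifferentiableAt 𝓘(ℝ, E) (𝓘(ℝ, E).prod 𝓘(ℝ, E))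
      (fun q => (⟨q, X q⟩ : TangentBundle 𝓘(ℝ, E) N1)) p)
    (hY : MDifferentiableAt 𝓘(ℝ, E) (𝓘(ℝ, E).prod 𝓘(ℝ, E))
      (fun q => (⟨q, Y q⟩ : TangentBundle 𝓘(ℝ, E) N1)) p) :
    leviCivita lam Y p (X p) - leviCivita lam X p (Y p) = vfBracket X Y p := by
  rw [← sub_eq_zero, ← sum_coframe h p (_ - _ - _)]
  refine Finset.sum_eq_zero fun c _ => ?_
  have := torsion_skewConnection (t := fun _ _ _ _ => 0) h (by simp) hX hY c
  change coframe lam c p (leviCivita lam Y p (X p) - leviCivita lam X p (Y p)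
        - vfBracket X Y p) = _ at this
  rw [this]
  simp

/-- The canonical connection is metric. -/
theorem canonicalConnection_metric {lam : ℝ} (h : 0 < lam) {Y Z : Π p : N1, T p} {p : N1}
    (hY : MDifferentiableAt 𝓘(ℝ, E) (𝓘(ℝ, E).prod 𝓘(ℝ, E))
      (fun q => (⟨q, Y q⟩ : TangentBundle 𝓘(ℝ, E) N1)) p)
    (hZ : MDifferentiableAt 𝓘(ℝ, E) (𝓘(ℝ, E).prod 𝓘(ℝ, E))
      (fun q => (⟨q, Z q⟩ : TangentBundle 𝓘(ℝ, E) N1)) p) (v : T p) :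
    mvfderiv 𝓘(ℝ, E) (fun q => metric lam q (Y q) (Z q)) p v =
      metric lam p (canonicalConnection lam Y p v) (Z p) +
        metric lam p (Y p) (canonicalConnection lam Z p v) :=
  metric_skewConnection (t := torsionCoeff lam) h (torsionCoeff_swap_right lam) hY hZ v

/-- The torsion of the canonical connection is the torsion form. -/
theorem canonicalConnection_torsion {lam : ℝ} (h : 0 < lam) (a b c : Idx) (p : N1) :
    metric lam p (canonicalConnection lam (frame lam b) p (frame lam a p)
        - canonicalConnection lam (frame lam a) p (frame lam b p)
        - vfBracket (frame lam a) (frame lam b) p) (frame lam c p) =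
      torsionForm lam (frame lam a) (frame lam b) (frame lam c) p := by
  rw [metric_symm]
  refine (torsion_skewConnection (t := torsionCoeff lam) h (torsionCoeff_swap_left lam)
    (mdifferentiableAt_frame lam a p) (mdifferentiableAt_frame lam b p) c).trans ?_
  rw [Finset.sum_eq_single a (fun x _ hx => by simp [coframe_frame h, hx]) (by simp)]
  simp [coframe_frame h, torsionCoeff]

/-! ### Spinors -/

/-- The quadratic form `x ↦ -|x|²` on `ℝ⁷`. -/
def cliffordForm : QuadraticForm ℝ (Idx → ℝ) :=
  QuadraticMap.weightedSumSquares ℝ (fun _ : Idx => (-1 : ℝ))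

/-- The Clifford algebra of `ℝ⁷`, with the relation `x · x = -|x|²`. -/
abbrev Cl : Type := CliffordAlgebra cliffordForm

/-- The generators `ξ₁, ξ₂, ξ₃, τ₁, …, τ₄` of the Clifford algebra. -/
def gen (a : Idx) : Cl := CliffordAlgebra.ι cliffordForm (Pi.single a 1)

/-- The volume element `ξ₁ · ξ₂ · ξ₃ · τ₁ · τ₂ · τ₃ · τ₄`. -/
def volumeElement : Cl :=
  gen (.inl 0) * gen (.inl 1) * gen (.inl 2) * gen (.inr 0) * gen (.inr 1) * gen (.inr 2)
    * gen (.inr 3)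

/-- A tangent vector at `p`, as an element of the Clifford algebra, by means of the orthonormal
frame. -/
def cliffVec (lam : ℝ) (p : N1) (v : T p) : Cl :=
  CliffordAlgebra.ι cliffordForm fun a => coframe lam a p v

/-- The torsion form at `p` as an element of the Clifford algebra (wedge products are replaced by
Clifford products): `∑_{a < b < c} T_{abc} e_a · e_b · e_c`. -/
def cliffTorsion (lam : ℝ) (p : N1) : Cl :=
  (1 / 6 : ℝ) • ∑ a, ∑ b, ∑ c, torsionCoeff lam a b c p • (gen a * gen b * gen c)

variable {Δ : Type*} [NormedAddCommGroup Δ] [NormedSpace ℝ Δ]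

/-- The covariant derivative of spinor fields induced by a metric connection `cov`. The spinor bundle
of the (unique) spin structure of `N₁` is trivialized by the global orthonormal frame, so that spinor
fields are maps from `N₁` to a spin module `Δ`, and
`∇_v ψ = dψ(v) + ¼ ∑_{a, b} g(∇_v e_a, e_b) e_a · e_b · ψ`. -/
def spinDeriv (lam : ℝ) (ρ : Cl →ₐ[ℝ] Module.End ℝ Δ)
    (cov : (Π p : N1, T p) → Π p : N1, T p →L[ℝ] T p) (ψ : N1 → Δ) (p : N1) (v : T p) : Δ :=
  mvfderiv 𝓘(ℝ, E) ψ p v + (1 / 4 : ℝ) • ∑ a, ∑ b,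
    metric lam p (cov (frame lam a) p v) (frame lam b p) • ρ (gen a * gen b) (ψ p)

/-- Smooth spinor fields parallel for the canonical connection `∇`. -/
def IsParallelSpinor (lam : ℝ) (ρ : Cl →ₐ[ℝ] Module.End ℝ Δ) (ψ : N1 → Δ) : Prop :=
  ContMDiff 𝓘(ℝ, E) 𝓘(ℝ, Δ) ∞ ψ ∧ ∀ p v, spinDeriv lam ρ (canonicalConnection lam) ψ p v = 0

/-- Generalized Killing spinors: smooth spinor fields `ψ`, not identically zero, with
`∇^g_X ψ = S(X) · ψ` for a smooth field `S` of symmetric endomorphisms of the tangent bundle. -/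
def IsGeneralizedKillingSpinor (lam : ℝ) (ρ : Cl →ₐ[ℝ] Module.End ℝ Δ) (ψ : N1 → Δ) : Prop :=
  ContMDiff 𝓘(ℝ, E) 𝓘(ℝ, Δ) ∞ ψ ∧ ψ ≠ 0 ∧
  ∃ S : Π p : N1, T p →L[ℝ] T p,
    (∀ X : Π p : N1, T p,
      ContMDiff 𝓘(ℝ, E) 𝓘(ℝ, E).tangent ∞ (fun p => (⟨p, X p⟩ : TangentBundle 𝓘(ℝ, E) N1)) →
      ContMDiff 𝓘(ℝ, E) 𝓘(ℝ, E).tangent ∞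
        (fun p => (⟨p, S p (X p)⟩ : TangentBundle 𝓘(ℝ, E) N1))) ∧
    (∀ p v w, metric lam p (S p v) w = metric lam p v (S p w)) ∧
    ∀ p v, spinDeriv lam ρ (leviCivita lam) ψ p v = ρ (cliffVec lam p (S p v)) (ψ p)

/-! ### Existence of the spin module: a realization on `ℍ ⊕ ℍ` -/

open scoped Quaternion

/-- The quaternionic component of a vector of `ℝ⁷ = Im ℍ ⊕ ℍ`. -/
def q4 (x : Idx → ℝ) : ℍ[ℝ] := ⟨x (.inr 0), x (.inr 1), x (.inr 2), x (.inr 3)⟩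

/-- The imaginary quaternionic component of a vector of `ℝ⁷ = Im ℍ ⊕ ℍ`. -/
def q3 (x : Idx → ℝ) : ℍ[ℝ] := ⟨0, x (.inl 0), x (.inl 1), x (.inl 2)⟩

@[simp] theorem q4_re (x : Idx → ℝ) : (q4 x).re = x (.inr 0) := rfl
@[simp] theorem q4_imI (x : Idx → ℝ) : (q4 x).imI = x (.inr 1) := rfl
@[simp] theorem q4_imJ (x : Idx → ℝ) : (q4 x).imJ = x (.inr 2) := rfl
@[simp] theorem q4_imK (x : Idx → ℝ) : (q4 x).imK = x (.inr 3) := rfl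
@[simp] theorem q3_re (x : Idx → ℝ) : (q3 x).re = 0 := rfl
@[simp] theorem q3_imI (x : Idx → ℝ) : (q3 x).imI = x (.inl 0) := rfl
@[simp] theorem q3_imJ (x : Idx → ℝ) : (q3 x).imJ = x (.inl 1) := rfl
@[simp] theorem q3_imK (x : Idx → ℝ) : (q3 x).imK = x (.inl 2) := rfl

/-- Clifford multiplication `(a, x) · (u, v) = (u a - x̄ v, x u - v a)` on `ℍ ⊕ ℍ`. -/
def spinMul : (Idx → ℝ) →ₗ[ℝ] Module.End ℝ (ℍ[ℝ] × ℍ[ℝ]) :=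
  LinearMap.mk₂ ℝ (fun x u => (u.1 * q3 x - star (q4 x) * u.2, q4 x * u.1 - u.2 * q3 x))
    (fun x y u => by ext <;> simp <;> ring)
    (fun c x u => by ext <;> simp <;> ring)
    (fun x u w => by ext <;> simp <;> ring)
    (fun c x u => by ext <;> simp <;> ring)

/-- A realization of the real spin representation. -/
def spinRep : Cl →ₐ[ℝ] Module.End ℝ (ℍ[ℝ] × ℍ[ℝ]) :=
  CliffordAlgebra.lift cliffordForm ⟨spinMul, fun x => by
    refine LinearMap.ext fun u => ?_
    ext <;> simp [spinMul, cliffordForm, QuadraticMap.weightedSumSquares_apply,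
      Fin.sum_univ_succ, Algebra.algebraMap_eq_smul_one] <;> ring⟩

theorem spinRep_volumeElement : spinRep volumeElement = 1 := by
  refine LinearMap.ext fun u => ?_
  simp only [volumeElement, gen, map_mul, spinRep, CliffordAlgebra.lift_ι_apply,
    Module.End.mul_apply]
  ext <;> simp [spinMul]

theorem finrank_spinRep : Module.finrank ℝ (ℍ[ℝ] × ℍ[ℝ]) = 8 := by
  simp [Quaternion.finrank_eq_four]

end QHeis

end

open scoped Manifold ContDiff

noncomputable section

namespace QHeis

/-! ### Structure constants of the frame -/

/-! In the left-invariant orthonormal frame all structure constants, and hence all connection and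
torsion components, are constant. A spin derivative is therefore the ordinary differential plus a
constant Clifford-algebra-valued `1`-form (`spinDeriv_skewConnection`), and most of the theorem
becomes algebra in one Clifford module.

Two facts reduce the parallel equation to linear algebra. In horizontal directions the Christoffel
symbols cancel against the torsion (`spinForm_canonical_inr`), so a `∇`-parallel spinor has
vanishing horizontal derivatives. Horizontal fields bracket-generate the tangent bundle, so such a
spinor is constant (`eq_const_of_horizontal_fderiv_eq_zero`). What remains are the three vertical
equations collected in `IsInvariantSpinor`.

These equations force the spinor to be fixed by three commuting involutions, each a product of four
generators up to sign (`fixed_of_isInvariantSpinor`). The projection onto the fixed space has trace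
`8 / 8 = 1`, so that space is a line (`finrank_fixedSpinors`). Conversely, when the volume element
acts as the identity, a fixed spinor `φ` satisfies seven relations `a · b · φ = c · φ`, the
multiplication table of a `G₂`-structure (`isG2Spinor_of_fixed`). The table gives back the vertical
equations, and hence `isParallelSpinor_iff`; it also gives the torsion eigenvalues and the Killing
numbers by direct evaluation. -/

/-- The matrix entries of the three forms `ω_i` on `ℍ`, with `[τ_a, τ_b] = ∑ i, ω_i(a, b) z_i`. -/
def omega (i : Fin 3) (a b : Fin 4) : ℝ :=
  bracket (Pi.single (.inr a) 1) (Pi.single (.inr b) 1) (.inl i)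

/-- The structure constants `g([e_a, e_b], e_c)` of the orthonormal frame. -/
def structConst (lam : ℝ) : Idx → Idx → Idx → ℝ
  | .inr a, .inr b, .inl i => lam * omega i a b
  | _, _, _ => 0

/-- The algebra is two-step nilpotent: `leftCLM p v` differs from `v` by a central vector, which the
bracket does not see. -/
theorem bracket_leftCLM (p v w : E) : bracket (leftCLM p v) w = bracket v w := by
  ext a
  rcases a with i | i <;> fin_cases i <;> simp [bracket, leftCLM]

theorem leftCLM_bracket (p v w : E) : leftCLM p (bracket v w) = bracket v w := by
  ext a
  rcases a with i | i <;> fin_cases i <;> simp [bracket, leftCLM]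

/-- The differential of the left-invariant vector field `p ↦ leftCLM p v`. -/
def halfBracketCLM (v : E) : E →L[ℝ] E :=
  LinearMap.toContinuousLinearMap
    { toFun := fun p => (1 / 2 : ℝ) • bracket p v
      map_add' := fun p q => by
        ext a
        rcases a with i | i <;> fin_cases i <;> simp [bracket] <;> ring
      map_smul' := fun c p => by
        ext a
        rcases a with i | i <;> fin_cases i <;> simp [bracket] <;> ring }

theorem hasFDerivAt_leftCLM (v p : E) :
    HasFDerivAt (fun p => leftCLM p v) (halfBracketCLM v) p :=
  ((halfBracketCLM v).hasFDerivAt (x := p)).const_add v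

theorem bracket_swap (v w : E) : bracket w v = -bracket v w := by
  ext a
  rcases a with i | i <;> fin_cases i <;> simp [bracket] <;> ring

/-- The derivative of `q ↦ leftCLM q v` is `½ [·, v]`, so the two derivative terms contribute `½ [v,
w]` and `-½ [w, v]`; the dependence on `p` drops out because brackets are central. -/
theorem lieBracket_leftCLM (v w p : E) :
    VectorField.lieBracket ℝ (fun q : E => leftCLM q v) (fun q : E => leftCLM q w) p =
      bracket v w := by
  simp only [VectorField.lieBracket]
  rw [(hasFDerivAt_leftCLM _ _).fderiv, (hasFDerivAt_leftCLM _ _).fderiv]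
  change (1 / 2 : ℝ) • bracket (leftCLM p _) _ - (1 / 2 : ℝ) • bracket (leftCLM p _) _ = _
  rw [bracket_leftCLM, bracket_leftCLM, bracket_swap v w]
  module

theorem vfBracket_frame (lam : ℝ) (a b : Idx) (p : N1) :
    vfBracket (frame lam a) (frame lam b) p = bracket (frameOne lam a) (frameOne lam b) := by
  have e : ∀ c, frame lam c = fun q : E => leftCLM q (frameOne lam c) := fun c =>
    funext (frame_eq lam c)
  rw [← lieBracket_leftCLM (frameOne lam a) (frameOne lam b) p, vfBracket, e, e,
    ← VectorField.lieBracketWithin_univ]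
  exact congrFun (VectorField.mlieBracketWithin_eq_lieBracketWithin (E := E)) p

theorem coframe_vfBracket_frame {lam : ℝ} (h : 0 < lam) (a b c : Idx) (p : N1) :
    coframe lam c p (vfBracket (frame lam a) (frame lam b) p) = structConst lam a b c := by
  rw [vfBracket_frame]
  refine (coframe_apply h c p _).trans ?_
  rw [maurerCartan_eq]
  -- The group inverse is negation in exponential coordinates, and the differential of a left
  -- translation fixes central vectors.
  change _ * leftCLM (Neg.neg (α := E) p) (bracket (frameOne lam a) (frameOne lam b)) c = _
  rw [leftCLM_bracket]
  rcases c with i | i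
  · rcases a with a | a <;> rcases b with b | b <;> fin_cases i <;>
      simp [structConst, bracket, frameOne, omega]
  · simp [structConst, bracket]

theorem christoffel_eq {lam : ℝ} (h : 0 < lam) (a b c : Idx) (p : N1) :
    christoffel lam a b c p =
      (1 / 2) * (structConst lam a b c - structConst lam b c a + structConst lam c a b) := by
  rw [christoffel, metric_symm lam p _ (frame lam c p), metric_symm lam p _ (frame lam a p),
    metric_symm lam p _ (frame lam b p), ← coframe_vfBracket_frame h a b c p,
    ← coframe_vfBracket_frame h b c a p, ← coframe_vfBracket_frame h c a b p]
  rfl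

theorem mvfderiv_coframe_frame {lam : ℝ} (h : 0 < lam) (a b : Idx) (p : N1) :
    mvfderiv 𝓘(ℝ, E) (fun q => coframe lam a q (frame lam b q)) p = 0 := by
  simp only [coframe_frame h]
  exact mvfderiv_const _

/-- This is the Maurer-Cartan equation: the frame and the coframe pair to constants, so only the
bracket term of the exterior derivative survives. -/
theorem extDerivOne_coframe {lam : ℝ} (h : 0 < lam) (a b c : Idx) (p : N1) :
    extDerivOne (coframe lam c) (frame lam a) (frame lam b) p = -structConst lam a b c := by
  rw [extDerivOne, mvfderiv_coframe_frame h, mvfderiv_coframe_frame h, coframe_vfBracket_frame h]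
  simp

/-- The components of `η₁ ∧ η₂ ∧ η₃`. -/
def leviCivitaSymbol (i j k : Fin 3) : ℝ :=
  Matrix.det (Matrix.of fun r s : Fin 3 =>
    if (.inl r : Idx) = ![.inl i, .inl j, .inl k] s then (1 : ℝ) else 0)

/-- The constant components of the torsion form. -/
def torsionConst (lam : ℝ) : Idx → Idx → Idx → ℝ
  | .inl i, .inl j, .inl k => -4 * lam * leviCivitaSymbol i j k
  | .inl i, .inr a, .inr b => -lam * omega i a b
  | .inr a, .inr b, .inl i => -lam * omega i a b
  | .inr b, .inl i, .inr a => -lam * omega i a b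
  | _, _, _ => 0

theorem torsionCoeff_eq {lam : ℝ} (h : 0 < lam) (a b c : Idx) (p : N1) :
    torsionCoeff lam a b c p = torsionConst lam a b c := by
  rw [torsionCoeff, torsionForm]
  simp only [extDerivOne_coframe h, coframe_frame h]
  have hdet : (Matrix.of fun i j : Fin 3 =>
      coframe lam (.inl i) p (![frame lam a p, frame lam b p, frame lam c p] j)) =
      Matrix.of fun i j : Fin 3 => if (.inl i : Idx) = ![a, b, c] j then 1 else 0 := by
    ext i j
    rw [Matrix.of_apply, Matrix.of_apply]
    fin_cases j <;> exact coframe_frame h p _ _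
  rw [hdet]
  rcases a with a | a <;> rcases b with b | b <;> rcases c with c | c <;>
    simp [structConst, torsionConst, leviCivitaSymbol, Matrix.det_fin_three]

/-- The spin connection form of the metric connection with skew torsion `t`. -/
def spinForm (lam : ℝ) (t : Idx → Idx → Idx → ℝ) (c : Idx) : Cl :=
  (1 / 4 : ℝ) • ∑ a, ∑ b,
    ((1 / 2) * (structConst lam c a b - structConst lam a b c + structConst lam b c a)
      + (1 / 2) * t c a b) • (gen a * gen b)

/-- Differentiating the constant pairings of coframe and frame gives zero, so only the connection
coefficients remain. They do not depend on the point, and summing them over the pairs `(a, b)` first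
gives one Clifford element for each frame direction. -/
theorem spinDeriv_skewConnection {Δ : Type*} [NormedAddCommGroup Δ] [NormedSpace ℝ Δ] {lam : ℝ}
    (h : 0 < lam) (ρ : Cl →ₐ[ℝ] Module.End ℝ Δ)
    {t : Idx → Idx → Idx → N1 → ℝ} {t' : Idx → Idx → Idx → ℝ} (ht : ∀ a b c p, t a b c p = t' a b c)
    (ψ : N1 → Δ) (p : N1) (v : T p) :
    spinDeriv lam ρ (skewConnection lam t) ψ p v =
      mvfderiv 𝓘(ℝ, E) ψ p v + ∑ c, coframe lam c p v • ρ (spinForm lam t' c) (ψ p) := by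
  have key : ∀ a b, metric lam p (skewConnection lam t (frame lam a) p v) (frame lam b p) =
      ∑ c, ((1 / 2) * (structConst lam c a b - structConst lam a b c + structConst lam b c a)
        + (1 / 2) * t' c a b) * coframe lam c p v := by
    intro a b
    rw [metric_symm]
    change coframe lam b p _ = _
    rw [coframe_skewConnection h, mvfderiv_coframe_frame h]
    simp only [coframe_frame h, _root_.zero_apply, zero_add, christoffel_eq h, ht]
    refine Finset.sum_congr rfl fun c _ => ?_
    rw [Finset.sum_eq_single a (fun x _ hx => by simp [hx]) (by simp)]
    simp
  rw [spinDeriv]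
  congr 1
  simp only [key, spinForm, map_smul, map_sum, LinearMap.smul_apply, LinearMap.sum_apply,
    Finset.smul_sum, Finset.sum_smul, smul_smul]
  conv_rhs => rw [Finset.sum_comm]
  refine Finset.sum_congr rfl fun a _ => ?_
  conv_rhs => rw [Finset.sum_comm]
  refine Finset.sum_congr rfl fun b _ => Finset.sum_congr rfl fun c _ => ?_
  congr 1
  ring

/-! ### The spin connection and the torsion in the Clifford algebra -/

theorem omega_eq : omega =
    ![![![0, 1, 0, 0], ![-1, 0, 0, 0], ![0, 0, 0, 1], ![0, 0, -1, 0]],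
      ![![0, 0, 1, 0], ![0, 0, 0, -1], ![-1, 0, 0, 0], ![0, 1, 0, 0]],
      ![![0, 0, 0, 1], ![0, 0, 1, 0], ![0, -1, 0, 0], ![-1, 0, 0, 0]]] := by
  ext i a b
  fin_cases i <;> fin_cases a <;> fin_cases b <;> simp [omega, bracket]

theorem leviCivitaSymbol_eq : leviCivitaSymbol =
    ![![![0, 0, 0], ![0, 0, 1], ![0, -1, 0]],
      ![![0, 0, -1], ![0, 0, 0], ![1, 0, 0]],
      ![![0, 1, 0], ![-1, 0, 0], ![0, 0, 0]]] := by
  ext i j k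
  fin_cases i <;> fin_cases j <;> fin_cases k <;>
    simp [leviCivitaSymbol, Matrix.det_fin_three]

theorem cliffordForm_apply (x : Idx → ℝ) : cliffordForm x = -∑ a, x a * x a := by
  rw [cliffordForm, QuadraticMap.weightedSumSquares_apply]
  simp

theorem gen_mul_self (a : Idx) : gen a * gen a = -1 := by
  rw [gen, CliffordAlgebra.ι_sq_scalar, cliffordForm_apply,
    Finset.sum_eq_single a (fun b _ hb => by simp [hb]) (by simp)]
  simp

theorem gen_mul_comm {a b : Idx} (h : a ≠ b) : gen a * gen b = -(gen b * gen a) := by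
  have h0 : QuadraticMap.polar cliffordForm (Pi.single a (1 : ℝ)) (Pi.single b 1) = 0 := by
    simp only [QuadraticMap.polar, cliffordForm_apply, ← Finset.sum_neg_distrib,
      ← Finset.sum_sub_distrib]
    refine Finset.sum_eq_zero fun c _ => ?_
    by_cases h1 : c = a
    · subst h1
      simp [h]
    · simp [h1]
  rw [eq_neg_iff_add_eq_zero, gen, gen, CliffordAlgebra.ι_mul_ι_add_swap, h0, map_zero]

/-! ### Normal forms that use only anticommutation -/

section Anticommuting

variable {A : Type*} [Ring A] {g : Idx → A}

/-- A family of pairwise anticommuting elements. -/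
def Anticommuting (g : Idx → A) : Prop := ∀ a b, a ≠ b → g a * g b = -(g b * g a)

namespace Anticommuting

theorem mul_left_comm (hg : Anticommuting g) {a b : Idx} (h : a ≠ b) (y : A) :
    g a * (g b * y) = -(g b * (g a * y)) := by
  rw [← mul_assoc, hg a b h, neg_mul, mul_assoc]

theorem inr_mul_inl (hg : Anticommuting g) (a : Fin 4) (i : Fin 3) :
    g (.inr a) * g (.inl i) = -(g (.inl i) * g (.inr a)) :=
  hg _ _ (by simp)

theorem inr_mul_inl_mul (hg : Anticommuting g) (a : Fin 4) (i : Fin 3) (y : A) :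
    g (.inr a) * (g (.inl i) * y) = -(g (.inl i) * (g (.inr a) * y)) :=
  hg.mul_left_comm (by simp) y

theorem inr_swap (hg : Anticommuting g) {a b : Fin 4} (h : b < a) :
    g (.inr a) * g (.inr b) = -(g (.inr b) * g (.inr a)) :=
  hg _ _ (by simpa using h.ne')

theorem inl_swap (hg : Anticommuting g) {a b : Fin 3} (h : b < a) :
    g (.inl a) * g (.inl b) = -(g (.inl b) * g (.inl a)) :=
  hg _ _ (by simpa using h.ne')

theorem inl_swap_mul (hg : Anticommuting g) {a b : Fin 3} (h : b < a) (y : A) :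
    g (.inl a) * (g (.inl b) * y) = -(g (.inl b) * (g (.inl a) * y)) :=
  hg.mul_left_comm (by simpa using h.ne') y

variable [Algebra ℝ A]

/-- Each unordered pair of generators occurs twice, with two sign changes that cancel. On horizontal
pairs the torsion doubles the Levi-Civita coefficient; the vertical pair comes from the term `-4 λ
η₁ ∧ η₂ ∧ η₃` alone. -/
theorem sum_canonical_inl (hg : Anticommuting g) (lam : ℝ) (i : Fin 3) :
    (1 / 4 : ℝ) • ∑ a, ∑ b, ((1 / 2) * (structConst lam (.inl i) a b
        - structConst lam a b (.inl i) + structConst lam b (.inl i) a)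
        + (1 / 2) * torsionConst lam (.inl i) a b) • (g a * g b) = (-lam / 2) •
      ![g (.inr 0) * g (.inr 1) + g (.inr 2) * g (.inr 3) + (2 : ℝ) • (g (.inl 1) * g (.inl 2)),
        g (.inr 0) * g (.inr 2) + g (.inr 3) * g (.inr 1) + (2 : ℝ) • (g (.inl 2) * g (.inl 0)),
        g (.inr 0) * g (.inr 3) + g (.inr 1) * g (.inr 2)
          + (2 : ℝ) • (g (.inl 0) * g (.inl 1))] i := by
  fin_cases i <;>
    simp [Fin.sum_univ_succ, structConst, torsionConst, omega_eq, leviCivitaSymbol_eq,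
      hg.inr_swap, hg.inl_swap] <;> module

theorem sum_leviCivita_inl (hg : Anticommuting g) (lam : ℝ) (i : Fin 3) :
    (1 / 4 : ℝ) • ∑ a, ∑ b, ((1 / 2) * (structConst lam (.inl i) a b
        - structConst lam a b (.inl i) + structConst lam b (.inl i) a)
        + (1 / 2) * 0) • (g a * g b) = (-lam / 4) •
      ![g (.inr 0) * g (.inr 1) + g (.inr 2) * g (.inr 3),
        g (.inr 0) * g (.inr 2) + g (.inr 3) * g (.inr 1),
        g (.inr 0) * g (.inr 3) + g (.inr 1) * g (.inr 2)] i := by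
  fin_cases i <;>
    simp [Fin.sum_univ_succ, structConst, omega_eq, hg.inr_swap] <;> module

theorem sum_leviCivita_inr (hg : Anticommuting g) (lam : ℝ) (a : Fin 4) :
    (1 / 4 : ℝ) • ∑ b, ∑ c, ((1 / 2) * (structConst lam (.inr a) b c
        - structConst lam b c (.inr a) + structConst lam c (.inr a) b)
        + (1 / 2) * 0) • (g b * g c) =
      (lam / 4) • ∑ b, ∑ i, omega i a b • (g (.inr b) * g (.inl i)) := by
  fin_cases a <;>
    simp [Fin.sum_univ_succ, structConst, omega_eq, hg.inr_mul_inl] <;> module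

theorem sum_torsionConst (hg : Anticommuting g) (lam : ℝ) :
    (1 / 6 : ℝ) • ∑ a, ∑ b, ∑ c, torsionConst lam a b c • (g a * g b * g c) = (-lam) •
      (g (.inl 0) * (g (.inr 0) * g (.inr 1) + g (.inr 2) * g (.inr 3))
        + g (.inl 1) * (g (.inr 0) * g (.inr 2) + g (.inr 3) * g (.inr 1))
        + g (.inl 2) * (g (.inr 0) * g (.inr 3) + g (.inr 1) * g (.inr 2))
        + (4 : ℝ) • (g (.inl 0) * (g (.inl 1) * g (.inl 2)))) := by
  simp [torsionConst, mul_assoc, mul_add, Fin.sum_univ_succ, omega_eq, leviCivitaSymbol_eq,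
    hg.inr_swap, hg.inl_swap, hg.inr_mul_inl, hg.inr_mul_inl_mul, hg.inl_swap_mul]
  generalize g (.inl 0) * (g (.inl 1) * g (.inl 2)) = x₀
  module

end Anticommuting

end Anticommuting

theorem anticommuting_gen : Anticommuting gen := fun _ _ => gen_mul_comm

/-- The mixed components of the torsion are exactly opposite to twice the Christoffel symbols in
horizontal directions, so the frame is `∇`-parallel along them. -/
theorem spinForm_canonical_inr (lam : ℝ) (a : Fin 4) :
    spinForm lam (torsionConst lam) (.inr a) = 0 := by
  rw [spinForm]
  fin_cases a <;>
    simp [Fin.sum_univ_succ, structConst, torsionConst, omega_eq]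

theorem spinForm_canonical_inl (lam : ℝ) (i : Fin 3) :
    spinForm lam (torsionConst lam) (.inl i) = (-lam / 2) •
      ![gen (.inr 0) * gen (.inr 1) + gen (.inr 2) * gen (.inr 3)
          + (2 : ℝ) • (gen (.inl 1) * gen (.inl 2)),
        gen (.inr 0) * gen (.inr 2) + gen (.inr 3) * gen (.inr 1)
          + (2 : ℝ) • (gen (.inl 2) * gen (.inl 0)),
        gen (.inr 0) * gen (.inr 3) + gen (.inr 1) * gen (.inr 2)
          + (2 : ℝ) • (gen (.inl 0) * gen (.inl 1))] i :=
  anticommuting_gen.sum_canonical_inl lam i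

theorem spinForm_leviCivita_inl (lam : ℝ) (i : Fin 3) :
    spinForm lam (fun _ _ _ => 0) (.inl i) = (-lam / 4) •
      ![gen (.inr 0) * gen (.inr 1) + gen (.inr 2) * gen (.inr 3),
        gen (.inr 0) * gen (.inr 2) + gen (.inr 3) * gen (.inr 1),
        gen (.inr 0) * gen (.inr 3) + gen (.inr 1) * gen (.inr 2)] i :=
  anticommuting_gen.sum_leviCivita_inl lam i

theorem spinForm_leviCivita_inr (lam : ℝ) (a : Fin 4) :
    spinForm lam (fun _ _ _ => 0) (.inr a) = (lam / 4) •
      ∑ b, ∑ i, omega i a b • (gen (.inr b) * gen (.inl i)) :=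
  anticommuting_gen.sum_leviCivita_inr lam a

theorem cliffTorsion_eq {lam : ℝ} (h : 0 < lam) (p : N1) :
    cliffTorsion lam p = (-lam) •
      (gen (.inl 0) * (gen (.inr 0) * gen (.inr 1) + gen (.inr 2) * gen (.inr 3))
        + gen (.inl 1) * (gen (.inr 0) * gen (.inr 2) + gen (.inr 3) * gen (.inr 1))
        + gen (.inl 2) * (gen (.inr 0) * gen (.inr 3) + gen (.inr 1) * gen (.inr 2))
        + (4 : ℝ) • (gen (.inl 0) * (gen (.inl 1) * gen (.inl 2)))) := by
  simp only [cliffTorsion, torsionCoeff_eq h]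
  exact anticommuting_gen.sum_torsionConst lam

/-! ### The spinors annihilated by the canonical spin connection -/

/-- Seven pairwise anticommuting square roots of `-1`. -/
structure IsCliffordFrame {A : Type*} [Ring A] (g : Idx → A) : Prop where
  anticomm : Anticommuting g
  mul_self : ∀ a, g a * g a = -1

theorem isCliffordFrame_gen {A : Type*} [Ring A] [Algebra ℝ A] (ρ : Cl →ₐ[ℝ] A) :
    IsCliffordFrame fun a => ρ (gen a) where
  anticomm a b h := by rw [← map_mul, gen_mul_comm h, map_neg, map_mul]
  mul_self a := by rw [← map_mul, gen_mul_self, map_neg, map_one]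

namespace IsCliffordFrame

/-! ### Three commuting involutions -/

section Ring

variable {A : Type*} [Ring A] {g : Idx → A}

theorem mul_self_mul (hg : IsCliffordFrame g) (a : Idx) (y : A) : g a * (g a * y) = -y := by
  rw [← mul_assoc, hg.mul_self, neg_one_mul]

theorem inr_swap_mul (hg : IsCliffordFrame g) {a b : Fin 4} (h : b < a) (y : A) :
    g (.inr a) * (g (.inr b) * y) = -(g (.inr b) * (g (.inr a) * y)) :=
  hg.anticomm.mul_left_comm (by simpa using h.ne') y

/-- The negative volume element of `T^h`. -/
def invH (g : Idx → A) : A := -(g (.inr 0) * g (.inr 1) * g (.inr 2) * g (.inr 3))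

/-- The first mixed involution fixing the parallel spinors. -/
def invI (g : Idx → A) : A := g (.inl 1) * g (.inl 2) * g (.inr 0) * g (.inr 1)

/-- The second mixed involution fixing the parallel spinors. -/
def invJ (g : Idx → A) : A := g (.inl 2) * g (.inl 0) * g (.inr 0) * g (.inr 2)

/-- A product of four distinct anticommuting roots of `-1` squares to `1`. Two such products sharing
an even number of factors commute, and here any two share exactly two. A single generator
anticommutes with such a product exactly when it occurs in it. -/
theorem involution_relations (hg : IsCliffordFrame g) :
    (invH g * invH g = 1 ∧ invI g * invI g = 1 ∧ invJ g * invJ g = 1) ∧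
    (invI g * invH g = invH g * invI g ∧ invJ g * invH g = invH g * invJ g ∧
      invJ g * invI g = invI g * invJ g) ∧
    (g (.inr 3) * invH g = -(invH g * g (.inr 3)) ∧ g (.inr 3) * invI g = invI g * g (.inr 3) ∧
      g (.inr 3) * invJ g = invJ g * g (.inr 3)) ∧
    (g (.inl 1) * invI g = -(invI g * g (.inl 1)) ∧ g (.inl 1) * invJ g = invJ g * g (.inl 1)) ∧
    g (.inl 0) * invJ g = -(invJ g * g (.inl 0)) := by
  simp only [invH, invI, invJ]
  refine ⟨⟨?_, ?_, ?_⟩, ⟨?_, ?_, ?_⟩, ⟨?_, ?_, ?_⟩, ⟨?_, ?_⟩, ?_⟩ <;>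
  simp [mul_assoc, hg.anticomm.inr_mul_inl, hg.anticomm.inr_mul_inl_mul, hg.anticomm.inr_swap,
    hg.inr_swap_mul, hg.anticomm.inl_swap, hg.anticomm.inl_swap_mul, hg.mul_self, hg.mul_self_mul]

end Ring

section Module

variable {V : Type*} [AddCommGroup V] [Module ℝ V] {g : Idx → Module.End ℝ V}

theorem apply_apply_self (hg : IsCliffordFrame g) (a : Idx) (φ : V) : g a (g a φ) = -φ := by
  simpa using congrArg (fun f : Module.End ℝ V => f φ) (hg.mul_self a)

theorem apply_apply_comm (hg : IsCliffordFrame g) {a b : Idx} (h : a ≠ b) (φ : V) :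
    g a (g b φ) = -g b (g a φ) := by
  simpa using congrArg (fun f : Module.End ℝ V => f φ) (hg.anticomm a b h)

theorem apply_inr_inl (hg : IsCliffordFrame g) (a : Fin 4) (i : Fin 3) (φ : V) :
    g (.inr a) (g (.inl i) φ) = -g (.inl i) (g (.inr a) φ) :=
  hg.apply_apply_comm (by simp) φ

theorem apply_inr_swap (hg : IsCliffordFrame g) {a b : Fin 4} (h : b < a) (φ : V) :
    g (.inr a) (g (.inr b) φ) = -g (.inr b) (g (.inr a) φ) :=
  hg.apply_apply_comm (by simpa using h.ne') φ

theorem apply_inl_swap (hg : IsCliffordFrame g) {a b : Fin 3} (h : b < a) (φ : V) :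
    g (.inl a) (g (.inl b) φ) = -g (.inl b) (g (.inl a) φ) :=
  hg.apply_apply_comm (by simpa using h.ne') φ

/-- Three generators that act on `φ` like the quaternion units: `a · b · φ = c · φ`, together with
the five equations that follow from this one. -/
def QuaternionicTriple (g : Idx → Module.End ℝ V) (φ : V) (a b c : Idx) : Prop :=
  (g a (g b φ) = g c φ ∧ g b (g c φ) = g a φ ∧ g c (g a φ) = g b φ) ∧
    g b (g a φ) = -g c φ ∧ g c (g b φ) = -g a φ ∧ g a (g c φ) = -g b φ

/-- Multiplying `a · b · φ = c · φ` by `a` or `b` and using anticommutation produces the other five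
relations. -/
theorem cyclic (hg : IsCliffordFrame g) {a b c : Idx} {φ : V} (h : g a (g b φ) = g c φ)
    (hab : a ≠ b) (hac : a ≠ c) (hbc : b ≠ c) : QuaternionicTriple g φ a b c := by
  have h1 : g b (g c φ) = g a φ := by
    rw [← h, hg.apply_apply_comm hab.symm, hg.apply_apply_self, map_neg, neg_neg]
  have h2 : g a (g c φ) = -g b φ := by rw [← h, hg.apply_apply_self]
  refine ⟨⟨h, h1, ?_⟩, ?_, ?_, h2⟩
  · rw [hg.apply_apply_comm hac.symm, h2, neg_neg]
  · rw [hg.apply_apply_comm hab.symm, h]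
  · rw [hg.apply_apply_comm hbc.symm, h1]

/-! ### The fixed spinors form a line -/

/-- The hypotheses give `u (a b) u = a b`, while cyclicity of the trace and `u² = -1` give the
opposite sign. -/
theorem trace_mul_eq_zero (u : Module.End ℝ V) {a b : Module.End ℝ V} (hu : u * u = -1)
    (ha : u * a = -(a * u)) (hb : u * b = b * u) : LinearMap.trace ℝ V (a * b) = 0 := by
  have h1 : u * (a * b) * u = a * b := by
    rw [← mul_assoc, ha, neg_mul, neg_mul, mul_assoc a, hb, mul_assoc a, mul_assoc b, hu]
    simp
  have h2 : LinearMap.trace ℝ V (u * (a * b) * u) = -LinearMap.trace ℝ V (a * b) := by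
    rw [LinearMap.trace_mul_comm, ← mul_assoc, hu, neg_one_mul, map_neg]
  rw [h1] at h2
  linarith

/-- The projection onto the spinors fixed by the three involutions. -/
def fixedProj (g : Idx → Module.End ℝ V) : Module.End ℝ V :=
  (1 / 8 : ℝ) • ((1 + invH g) * ((1 + invI g) * (1 + invJ g)))

theorem trace_fixedProj (hg : IsCliffordFrame g) (h8 : Module.finrank ℝ V = 8) :
    LinearMap.trace ℝ V (fixedProj g) = 1 := by
  have : FiniteDimensional ℝ V := Module.finite_of_finrank_pos (by omega)
  obtain ⟨-, -, ⟨h1, h2, h3⟩, ⟨h4, h5⟩, h6⟩ := hg.involution_relations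
  -- The auxiliary generators are `τ₄`, which occurs only in `invH`; `ξ₂`, which occurs in `invI`
  -- but not in `invJ`; and `ξ₁`, which occurs in `invJ`. They eliminate every term of the expanded
  -- product except the identity.
  have e1 := trace_mul_eq_zero (g (.inr 3)) (b := (1 + invI g) * (1 + invJ g)) (hg.mul_self _) h1
    (by simp only [mul_add, add_mul, mul_one, one_mul, ← mul_assoc, h2, h3]
        simp only [mul_assoc, h3])
  have e2 := trace_mul_eq_zero (g (.inl 1)) (b := 1 + invJ g) (hg.mul_self _) h4
    (by simp only [mul_add, add_mul, mul_one, one_mul, h5])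
  have e3 := trace_mul_eq_zero (g (.inl 0)) (b := 1) (hg.mul_self _) h6 (by simp)
  rw [mul_one] at e3
  rw [fixedProj, map_smul, add_mul, map_add, e1, one_mul, add_mul, map_add, e2, one_mul, map_add,
    e3, LinearMap.trace_one, h8]
  norm_num

/-- The spinors fixed by the three involutions. -/
def fixedSpinors (g : Idx → Module.End ℝ V) : Submodule ℝ V where
  carrier := {φ | invH g φ = φ ∧ invI g φ = φ ∧ invJ g φ = φ}
  add_mem' := fun ⟨h1, h2, h3⟩ ⟨h1', h2', h3'⟩ => by
    refine ⟨?_, ?_, ?_⟩ <;> simp only [map_add, *]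
  zero_mem' := by simp
  smul_mem' := fun c φ ⟨h1, h2, h3⟩ => by
    refine ⟨?_, ?_, ?_⟩ <;> simp only [map_smul, *]

theorem mem_fixedSpinors {φ : V} :
    φ ∈ fixedSpinors g ↔ invH g φ = φ ∧ invI g φ = φ ∧ invJ g φ = φ := Iff.rfl

theorem isProj_fixedProj (hg : IsCliffordFrame g) :
    LinearMap.IsProj (fixedSpinors g) (fixedProj g) where
  map_mem φ := by
    obtain ⟨⟨h1, h2, h3⟩, ⟨h4, h5, h6⟩, -⟩ := hg.involution_relations
    have fix : ∀ {u v : Module.End ℝ V}, u * v = v → u (v φ) = v φ := fun {u v} h =>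
      congrArg (fun f : Module.End ℝ V => f φ) h
    -- Each involution `u` is moved past the other factors to its own, where `u (1 + u) = 1 + u`.
    refine ⟨fix ?_, fix ?_, fix ?_⟩
    · rw [fixedProj, mul_smul_comm, ← mul_assoc, mul_add, mul_one, h1, add_comm]
    · rw [fixedProj, mul_smul_comm, ← mul_assoc, show invI g * (1 + invH g) =
        (1 + invH g) * invI g by rw [mul_add, add_mul, h4, mul_one, one_mul], mul_assoc,
        ← mul_assoc (invI g), mul_add (invI g), mul_one, h2, add_comm (invI g)]
    · rw [fixedProj, mul_smul_comm, ← mul_assoc, show invJ g * (1 + invH g) =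
        (1 + invH g) * invJ g by rw [mul_add, add_mul, h5, mul_one, one_mul], mul_assoc,
        ← mul_assoc (invJ g), show invJ g * (1 + invI g) =
        (1 + invI g) * invJ g by rw [mul_add, add_mul, h6, mul_one, one_mul], mul_assoc,
        mul_add (invJ g), mul_one, h3, add_comm (invJ g)]
  map_id φ hφ := by
    obtain ⟨h1, h2, h3⟩ := hφ
    have e : ∀ {u : Module.End ℝ V} {c : ℝ}, u φ = φ → (1 + u) (c • φ) = (2 * c) • φ :=
      fun {u c} h => by
        rw [LinearMap.add_apply, Module.End.one_apply, map_smul, h]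
        module
    -- Each of the three factors doubles a fixed spinor, which cancels the normalization `1 / 8`.
    have e3 := e (c := 1) h3
    rw [one_smul] at e3
    rw [fixedProj, LinearMap.smul_apply, Module.End.mul_apply, Module.End.mul_apply, e3, e h2,
      e h1]
    module

theorem finrank_fixedSpinors (hg : IsCliffordFrame g) (h8 : Module.finrank ℝ V = 8) :
    Module.finrank ℝ (fixedSpinors g) = 1 := by
  have : FiniteDimensional ℝ V := Module.finite_of_finrank_pos (by omega)
  have := hg.isProj_fixedProj.trace
  rw [hg.trace_fixedProj h8] at this
  exact_mod_cast this.symm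

/-! ### The multiplication table of a `G₂`-spinor -/

/-- The volume element. -/
def vol (g : Idx → Module.End ℝ V) : Module.End ℝ V :=
  g (.inl 0) * g (.inl 1) * g (.inl 2) * g (.inr 0) * g (.inr 1) * g (.inr 2) * g (.inr 3)

/-- The seven quaternionic triples of a spinor, which define a `G₂`-structure. -/
structure IsG2Spinor (g : Idx → Module.End ℝ V) (φ : V) : Prop where
  vvv : g (.inl 0) (g (.inl 1) φ) = g (.inl 2) φ
  hhv₁ : g (.inr 1) (g (.inr 0) φ) = g (.inl 0) φ
  hhv₁' : g (.inr 3) (g (.inr 2) φ) = g (.inl 0) φ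
  hhv₂ : g (.inr 2) (g (.inr 0) φ) = g (.inl 1) φ
  hhv₂' : g (.inr 1) (g (.inr 3) φ) = g (.inl 1) φ
  hhv₃ : g (.inr 3) (g (.inr 0) φ) = g (.inl 2) φ
  hhv₃' : g (.inr 2) (g (.inr 1) φ) = g (.inl 2) φ

/-- The volume condition and `invH` determine the vertical triple; `invI` and `invJ` then express
`ξ₁ · φ` and `ξ₂ · φ` by horizontal products. The rest follows from these by anticommutation. -/
theorem isG2Spinor_of_fixed (hg : IsCliffordFrame g) (hv : vol g = 1) {φ : V}
    (h : φ ∈ fixedSpinors g) : IsG2Spinor g φ := by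
  obtain ⟨hA, hB, hC⟩ := h
  have hv' := congrArg (fun f : Module.End ℝ V => f φ) hv
  simp only [vol, Module.End.mul_apply, Module.End.one_apply] at hv'
  simp only [invH, invI, invJ, Module.End.mul_apply, LinearMap.neg_apply] at hA hB hC
  rw [neg_eq_iff_eq_neg] at hA
  rw [hA] at hv'
  have swap : ∀ a b (χ : V), a ≠ b → g a (g b χ) = -g b (g a χ) := fun a b χ h =>
    hg.apply_apply_comm h χ
  have self := hg.apply_apply_self
  -- On `φ` the horizontal volume element acts as `-1`, so the orientation condition leaves `ξ₁ · ξ₂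
  -- · ξ₃ · φ = -φ`.
  have v0 : g (.inl 1) (g (.inl 2) φ) = g (.inl 0) φ := by
    have := congrArg (g (.inl 0)) hv'
    simpa [self] using this
  obtain ⟨⟨-, v1, v2⟩, v3, v4, v5⟩ := hg.cyclic v0 (by simp) (by simp) (by simp)
  -- This form of the `invH` equation exchanges a horizontal pair for the complementary pair, which
  -- gives the primed relations.
  have hA' : g (.inr 1) (g (.inr 2) (g (.inr 3) φ)) = g (.inr 0) φ := by
    have := congrArg (g (.inr 0)) hA
    simpa [self] using this
  have h₁ : g (.inr 1) (g (.inr 0) φ) = g (.inl 0) φ := by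
    have := congrArg (fun χ => g (.inl 2) (g (.inl 1) χ)) hB
    simp only [self, map_neg, neg_neg, v3] at this
    rw [swap _ _ _ (by simp), this, neg_neg]
  have h₂ : g (.inr 2) (g (.inr 0) φ) = g (.inl 1) φ := by
    have := congrArg (fun χ => g (.inl 0) (g (.inl 2) χ)) hC
    simp only [self, map_neg, neg_neg, v4] at this
    rw [swap _ _ _ (by simp), this, neg_neg]
  have h₁' : g (.inr 3) (g (.inr 2) φ) = g (.inl 0) φ := by
    rw [swap _ _ _ (by simp), ← h₁, ← hA', self]
  have h₂' : g (.inr 1) (g (.inr 3) φ) = g (.inl 1) φ := by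
    rw [← h₂, ← hA', swap (.inr 2) (.inr 1) _ (by simp), self, map_neg, neg_neg]
  have h₃ : g (.inr 3) (g (.inr 0) φ) = g (.inl 2) φ := by
    obtain ⟨⟨-, -, e⟩, -⟩ := hg.cyclic h₁ (by simp) (by simp) (by simp)
    -- The third relation is the composite of the first two, through `ξ₃ · φ = ξ₁ · ξ₂ · φ`.
    rw [← v2, ← h₂', swap (.inr 1) _ _ (by simp), map_neg, swap (.inl 0) _ _ (by simp), e, neg_neg]
  have h₃' : g (.inr 2) (g (.inr 1) φ) = g (.inl 2) φ := by
    rw [← h₃, ← hA', swap (.inr 3) _ _ (by simp), swap (.inr 3) _ _ (by simp), self, map_neg,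
      map_neg, map_neg, neg_neg, swap _ _ _ (by simp)]
  exact ⟨v2, h₁, h₁', h₂, h₂', h₃, h₃'⟩

/-- The equations for a constant parallel spinor. -/
def IsInvariantSpinor (g : Idx → Module.End ℝ V) (φ : V) : Prop :=
  g (.inr 0) (g (.inr 1) φ) + g (.inr 2) (g (.inr 3) φ) + (2 : ℝ) • g (.inl 1) (g (.inl 2) φ) = 0 ∧
  g (.inr 0) (g (.inr 2) φ) + g (.inr 3) (g (.inr 1) φ) + (2 : ℝ) • g (.inl 2) (g (.inl 0) φ) = 0 ∧
  g (.inr 0) (g (.inr 3) φ) + g (.inr 1) (g (.inr 2) φ) + (2 : ℝ) • g (.inl 0) (g (.inl 1) φ) = 0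

/-- The three bivectors in each equation commute and square to `-1`. Multiplying an equation by one
of its own bivectors turns it into a linear relation between `φ` and its images under products of
four generators; suitable combinations isolate the involutions. -/
theorem fixed_of_isInvariantSpinor (hg : IsCliffordFrame g) {φ : V} (h : IsInvariantSpinor g φ) :
    φ ∈ fixedSpinors g := by
  obtain ⟨h1, h2, -⟩ := h
  have f1 := congrArg (fun χ => g (.inr 0) (g (.inr 1) χ)) h1
  have f2 := congrArg (fun χ => g (.inr 2) (g (.inr 3) χ)) h1
  have f3 := congrArg (fun χ => g (.inl 1) (g (.inl 2) χ)) h1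
  have f4 := congrArg (fun χ => g (.inr 0) (g (.inr 2) χ)) h2
  rw [mem_fixedSpinors]
  simp only [map_add, map_smul, map_neg, map_zero, smul_neg, neg_neg, invH, invI, invJ,
    Module.End.mul_apply, LinearMap.neg_apply, hg.apply_apply_self, hg.apply_inr_inl,
    hg.apply_inr_swap, hg.apply_inl_swap, Fin.isValue, Fin.reduceLT] at f1 f2 f3 f4 ⊢
  refine ⟨?_, ?_, ?_⟩
  -- With `K = ξ₂ · ξ₃ · τ₃ · τ₄`, the left sides of `f1`, `f2`, `f3` are `-φ - invH φ + 2 invI φ`,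
  -- `-φ - invH φ + 2 K φ` and `invI φ + K φ - 2 φ`; that of `f4` is `-φ - invH φ + 2 invJ φ`. The
  -- coefficients eliminate `K φ`.
  · linear_combination (norm := module) (-1 / 2 : ℝ) • f1 - (1 / 2 : ℝ) • f2 + f3
  · linear_combination (norm := module) (1 / 4 : ℝ) • f1 - (1 / 4 : ℝ) • f2 + (1 / 2 : ℝ) • f3
  · linear_combination (norm := module) (1 / 2 : ℝ) • f4 - (1 / 4 : ℝ) • f1 - (1 / 4 : ℝ) • f2
      + (1 / 2 : ℝ) • f3

/-- The multiplication table of a `G₂`-spinor. -/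
theorem IsG2Spinor.table (hg : IsCliffordFrame g) {φ : V} (h : IsG2Spinor g φ) :
    QuaternionicTriple g φ (.inl 0) (.inl 1) (.inl 2) ∧
    (QuaternionicTriple g φ (.inr 1) (.inr 0) (.inl 0) ∧
      QuaternionicTriple g φ (.inr 3) (.inr 2) (.inl 0)) ∧
    (QuaternionicTriple g φ (.inr 2) (.inr 0) (.inl 1) ∧
      QuaternionicTriple g φ (.inr 1) (.inr 3) (.inl 1)) ∧
    (QuaternionicTriple g φ (.inr 3) (.inr 0) (.inl 2) ∧
      QuaternionicTriple g φ (.inr 2) (.inr 1) (.inl 2)) := by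
  refine ⟨hg.cyclic h.vvv ?_ ?_ ?_, ⟨hg.cyclic h.hhv₁ ?_ ?_ ?_, hg.cyclic h.hhv₁' ?_ ?_ ?_⟩,
    ⟨hg.cyclic h.hhv₂ ?_ ?_ ?_, hg.cyclic h.hhv₂' ?_ ?_ ?_⟩,
    ⟨hg.cyclic h.hhv₃ ?_ ?_ ?_, hg.cyclic h.hhv₃' ?_ ?_ ?_⟩⟩ <;> simp

/-- In the `i`-th equation the two horizontal products each give `-ξ_i · φ`, and the doubled
vertical product gives `2 ξ_i · φ`. -/
theorem IsG2Spinor.isInvariantSpinor (hg : IsCliffordFrame g) {φ : V} (h : IsG2Spinor g φ) :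
    IsInvariantSpinor g φ := by
  have t := h.table hg
  simp only [QuaternionicTriple] at t
  simp only [IsInvariantSpinor, t]
  refine ⟨?_, ?_, ?_⟩ <;> module

/-- The expression of the torsion form in the generators of the Clifford algebra. -/
def torsionEnd (lam : ℝ) (g : Idx → Module.End ℝ V) : Module.End ℝ V :=
  (-lam) •
    (g (.inl 0) * (g (.inr 0) * g (.inr 1) + g (.inr 2) * g (.inr 3))
      + g (.inl 1) * (g (.inr 0) * g (.inr 2) + g (.inr 3) * g (.inr 1))
      + g (.inl 2) * (g (.inr 0) * g (.inr 3) + g (.inr 1) * g (.inr 2))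
      + (4 : ℝ) • (g (.inl 0) * (g (.inl 1) * g (.inl 2))))

/-- Inside the bracket each of the three mixed terms contributes `2` and the vertical term `-4`. -/
theorem IsG2Spinor.torsionEnd_apply (hg : IsCliffordFrame g) {φ : V} (h : IsG2Spinor g φ)
    (lam : ℝ) : torsionEnd lam g φ = (-2 * lam) • φ := by
  have t := h.table hg
  simp only [QuaternionicTriple] at t
  simp only [torsionEnd, LinearMap.smul_apply, LinearMap.add_apply, Module.End.mul_apply, map_add,
    map_neg, t, hg.apply_apply_self]
  module

/-- Moving `ξ_i` past the mixed terms preserves the sign of the `i`-th and reverses the other two,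
while `ξ₁ · ξ₂ · ξ₃` commutes with `ξ_i`: the bracket becomes `2 - 2 - 2 - 4 = -6`. -/
theorem IsG2Spinor.torsionEnd_inl (hg : IsCliffordFrame g) {φ : V} (h : IsG2Spinor g φ)
    (lam : ℝ) (i : Fin 3) : torsionEnd lam g (g (.inl i) φ) = (6 * lam) • g (.inl i) φ := by
  have t := h.table hg
  simp only [QuaternionicTriple] at t
  fin_cases i <;>
  simp only [torsionEnd, LinearMap.smul_apply, LinearMap.add_apply, Module.End.mul_apply, map_add,
    map_neg, t, hg.apply_apply_self, Fin.zero_eta, Fin.mk_one, Fin.reduceFinMk] <;>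
  module

/-- In each mixed term one of the two products commutes with `τ_a` and the other anticommutes, so
they cancel. The vertical term changes sign, and the bracket becomes `4`. -/
theorem IsG2Spinor.torsionEnd_inr (hg : IsCliffordFrame g) {φ : V} (h : IsG2Spinor g φ)
    (lam : ℝ) (a : Fin 4) : torsionEnd lam g (g (.inr a) φ) = (-4 * lam) • g (.inr a) φ := by
  have t := h.table hg
  simp only [QuaternionicTriple] at t
  fin_cases a <;>
  simp only [torsionEnd, LinearMap.smul_apply, LinearMap.add_apply, Module.End.mul_apply, map_add,
    map_neg, t, hg.apply_apply_self, Fin.zero_eta, Fin.mk_one, Fin.reduceFinMk] <;>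
  module

theorem IsG2Spinor.leviCivita_inl (hg : IsCliffordFrame g) {φ : V} (h : IsG2Spinor g φ)
    (lam : ℝ) (i : Fin 3) : ((-lam / 4) •
      ![g (.inr 0) * g (.inr 1) + g (.inr 2) * g (.inr 3),
        g (.inr 0) * g (.inr 2) + g (.inr 3) * g (.inr 1),
        g (.inr 0) * g (.inr 3) + g (.inr 1) * g (.inr 2)] i) φ = (lam / 2) • g (.inl i) φ := by
  have t := h.table hg
  simp only [QuaternionicTriple] at t
  fin_cases i <;> simp [t] <;> module

/-- For each of the three `i` exactly one `b` has `omega i a b ≠ 0`, and each such term equals `-τ_a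
· φ`. -/
theorem IsG2Spinor.leviCivita_inr (hg : IsCliffordFrame g) {φ : V} (h : IsG2Spinor g φ)
    (lam : ℝ) (a : Fin 4) : ((lam / 4) •
      ∑ b, ∑ i, omega i a b • (g (.inr b) * g (.inl i))) φ =
        (-(3 * lam / 4)) • g (.inr a) φ := by
  have t := h.table hg
  simp only [QuaternionicTriple] at t
  fin_cases a <;> simp [t, omega_eq, Fin.sum_univ_succ] <;> module

end Module

end IsCliffordFrame

/-! ### Functions with vanishing horizontal derivatives -/

section Constancy

variable {F : Type*} [NormedAddCommGroup F] [NormedSpace ℝ F]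

theorem mulE_eq_add (p v : E) : mulE p v = p + leftCLM p v :=
  add_assoc p v ((1 / 2 : ℝ) • bracket p v)

theorem bracket_self (v : E) : bracket v v = 0 := by
  ext a
  rcases a with i | i <;> fin_cases i <;> simp [bracket] <;> ring

/-- Integral curves of left-invariant fields are straight lines in exponential coordinates: the
field is constant along its own direction since `[v, v] = 0` and brackets are central. -/
theorem leftCLM_add_smul (p v : E) (t : ℝ) : leftCLM (p + t • leftCLM p v) v = leftCLM p v := by
  change v + (1 / 2 : ℝ) • bracket (p + t • leftCLM p v) v = v + (1 / 2 : ℝ) • bracket p v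
  have : bracket (p + t • leftCLM p v) v = bracket p v + t • bracket (leftCLM p v) v := by
    ext a
    rcases a with i | i <;> fin_cases i <;> simp [bracket] <;> ring
  rw [this, bracket_leftCLM, bracket_self, smul_zero, add_zero]

/-- A function is constant along the integral curves of a left-invariant vector field along which
its derivative vanishes. -/
theorem apply_mulE_smul {f : E → F} (hf : Differentiable ℝ f) {v : E}
    (hv : ∀ p, fderiv ℝ f p (leftCLM p v) = 0) (p : E) (t : ℝ) : f (mulE p (t • v)) = f p := by
  have hd : ∀ s : ℝ, HasDerivAt (fun s : ℝ => f (p + s • leftCLM p v)) 0 s := fun s => by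
    have h1 : HasDerivAt (fun s : ℝ => p + s • leftCLM p v) (leftCLM p v) s := by
      simpa using ((hasDerivAt_id s).smul_const (leftCLM p v)).const_add p
    have h2 := (hf (p + s • leftCLM p v)).hasFDerivAt.comp_hasDerivAt s h1
    have h3 := hv (p + s • leftCLM p v)
    rw [leftCLM_add_smul] at h3
    rwa [h3] at h2
  have := is_const_of_deriv_eq_zero (fun s => (hd s).differentiableAt) (fun s => (hd s).deriv) t 0
  rw [mulE_eq_add, map_smul]
  simpa using this

/-- The translations that leave a function invariant. -/
def periods (f : E → F) : AddSubgroup E where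
  carrier := {v | ∀ p, f (p + v) = f p}
  add_mem' := fun {v w} hv hw p => by rw [← add_assoc, hw, hv]
  zero_mem' := fun p => by rw [add_zero]
  neg_mem' := fun {v} hv p => by rw [← hv (p + -v), neg_add_cancel_right]

/-- Since `[τ₁, τ_{i+1}] = z_i` for `i = 1, 2, 3`, a group commutator of horizontal one-parameter
subgroups is a translation in a central direction, of arbitrary length `s`. -/
theorem commutator_eq (p : E) (s : ℝ) (i : Fin 3) :
    mulE (mulE (mulE (mulE p (s • Pi.single (.inr 0) 1)) ((1 : ℝ) • Pi.single (.inr i.succ) 1))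
      ((-s) • Pi.single (.inr 0) 1)) ((-1 : ℝ) • Pi.single (.inr i.succ) 1) =
    p + Pi.single (.inl i) s := by
  ext a
  fin_cases i <;> rcases a with j | j <;> fin_cases j <;> simp [mulE, bracket] <;> ring

/-- The function is invariant under right multiplication by horizontal exponentials, hence by their
commutators, which are the central translations. Modulo the centre the product is addition, so every
vector is a period. -/
theorem eq_const_of_horizontal_fderiv_eq_zero {f : E → F} (hf : Differentiable ℝ f)
    (h : ∀ p (a : Fin 4), fderiv ℝ f p (leftCLM p (Pi.single (.inr a) 1)) = 0) (p : E) :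
    f p = f 0 := by
  have hmul := fun a => apply_mulE_smul hf (fun p => h p a)
  have hv : ∀ (i : Fin 3) (s : ℝ), (Pi.single (.inl i) s : E) ∈ periods f := fun i s p => by
    rw [← commutator_eq, hmul, hmul, hmul, hmul]
  have hvert : ∀ v : E, (∀ a, v (.inr a) = 0) → v ∈ periods f := fun v hv0 => by
    rw [← Finset.univ_sum_single v]
    refine sum_mem fun c _ => ?_
    rcases c with i | a
    · exact hv i _
    · rw [hv0, Pi.single_zero]
      exact zero_mem _
  have hh : ∀ (a : Fin 4) (s : ℝ), (Pi.single (.inr a) s : E) ∈ periods f := fun a s q => by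
    -- Addition differs from the group product by `½ [q, ·]`, which is vertical and therefore
    -- already a period.
    have h1 : q + Pi.single (.inr a) s = mulE q (s • Pi.single (.inr a) 1)
        + (-(1 / 2 : ℝ)) • bracket q (s • Pi.single (.inr a) 1) := by
      rw [mulE, ← Pi.single_smul, smul_eq_mul, mul_one]
      module
    rw [h1, hvert _ (fun b => by simp [bracket]), hmul]
  have hp : p ∈ periods f := by
    rw [← Finset.univ_sum_single p]
    refine sum_mem fun c _ => ?_
    rcases c with i | a
    · exact hv i _
    · exact hh a _
  have := hp 0
  rwa [zero_add] at this

end Constancy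

/-! ### Parallel spinors -/

section Parallel

variable {Δ : Type*} [NormedAddCommGroup Δ] [NormedSpace ℝ Δ]

open IsCliffordFrame

theorem spinDeriv_canonicalConnection {lam : ℝ} (h : 0 < lam) (ρ : Cl →ₐ[ℝ] Module.End ℝ Δ)
    (ψ : N1 → Δ) (p : N1) (v : T p) :
    spinDeriv lam ρ (canonicalConnection lam) ψ p v = mvfderiv 𝓘(ℝ, E) ψ p v
      + ∑ c, coframe lam c p v • ρ (spinForm lam (torsionConst lam) c) (ψ p) :=
  spinDeriv_skewConnection h ρ (torsionCoeff_eq h) ψ p v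

theorem spinDeriv_leviCivita {lam : ℝ} (h : 0 < lam) (ρ : Cl →ₐ[ℝ] Module.End ℝ Δ)
    (ψ : N1 → Δ) (p : N1) (v : T p) :
    spinDeriv lam ρ (leviCivita lam) ψ p v = mvfderiv 𝓘(ℝ, E) ψ p v
      + ∑ c, coframe lam c p v • ρ (spinForm lam (fun _ _ _ => 0) c) (ψ p) :=
  spinDeriv_skewConnection h ρ (fun _ _ _ _ => rfl) ψ p v

theorem sum_coframe_frame_smul {lam : ℝ} (h : 0 < lam) (p : N1) (a : Idx) (χ : Idx → Δ) :
    ∑ c, coframe lam c p (frame lam a p) • χ c = χ a := by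
  simp [coframe_frame h]

theorem vol_gen {ρ : Cl →ₐ[ℝ] Module.End ℝ Δ} (hρ : ρ volumeElement = 1) :
    vol (fun a => ρ (gen a)) = 1 := by
  rw [← hρ, volumeElement, vol]
  simp only [map_mul]

theorem isInvariantSpinor_iff {lam : ℝ} (h : 0 < lam) (ρ : Cl →ₐ[ℝ] Module.End ℝ Δ) (φ : Δ) :
    IsInvariantSpinor (fun a => ρ (gen a)) φ ↔
      ∀ c, ρ (spinForm lam (torsionConst lam) c) φ = 0 := by
  have h' : -lam / 2 ≠ 0 := by linarith
  rw [Sum.forall]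
  simp only [spinForm_canonical_inr, map_zero, LinearMap.zero_apply, implies_true, and_true,
    spinForm_canonical_inl, map_smul, LinearMap.smul_apply, smul_eq_zero, h', false_or]
  rw [Fin.forall_fin_succ, Fin.forall_fin_succ, Fin.forall_fin_succ]
  simp [IsInvariantSpinor]

theorem fderiv_horizontal_eq_zero {lam : ℝ} (h : 0 < lam) {ρ : Cl →ₐ[ℝ] Module.End ℝ Δ}
    {ψ : N1 → Δ} (hψ : IsParallelSpinor lam ρ ψ) (p : N1) (a : Fin 4) :
    fderiv ℝ (fun q : E => ψ q) p (leftCLM p (Pi.single (.inr a) 1)) = 0 := by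
  have h1 := hψ.2 p (frame lam (.inr a) p)
  rw [spinDeriv_canonicalConnection h, sum_coframe_frame_smul h, spinForm_canonical_inr, map_zero,
    LinearMap.zero_apply, add_zero, frame_eq] at h1
  have h2 : frameOne lam (.inr a) = Pi.single (.inr a) 1 := by simp [frameOne]
  rw [h2] at h1
  have h3 : mfderiv 𝓘(ℝ, E) 𝓘(ℝ, Δ) ψ p = fderiv ℝ (fun q : E => ψ q) p :=
    mfderiv_eq_fderiv (E := E)
  rw [← h3]
  exact h1

/-- Parallel spinors are constant, because horizontal derivatives vanish; on constants the equation
is purely algebraic. The volume condition enters only in the converse, through the `G₂` table. -/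
theorem isParallelSpinor_iff {lam : ℝ} (h : 0 < lam) {ρ : Cl →ₐ[ℝ] Module.End ℝ Δ}
    (hρ : ρ volumeElement = 1) {ψ : N1 → Δ} :
    IsParallelSpinor lam ρ ψ ↔ ∃ φ ∈ fixedSpinors (fun a => ρ (gen a)), ψ = fun _ => φ := by
  have hg := isCliffordFrame_gen ρ
  constructor
  · intro hψ
    have hd : Differentiable ℝ (fun q : E => ψ q) :=
      (contMDiff_iff_contDiff.1 hψ.1).differentiable (by simp)
    have hc : ψ = fun _ => ψ 1 := funext fun p =>
      eq_const_of_horizontal_fderiv_eq_zero hd (fderiv_horizontal_eq_zero h hψ) p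
    refine ⟨ψ 1, hg.fixed_of_isInvariantSpinor ((isInvariantSpinor_iff h ρ _).2 fun c => ?_), hc⟩
    have h1 := hψ.2 1 (frame lam c 1)
    rw [spinDeriv_canonicalConnection h, sum_coframe_frame_smul h] at h1
    rw [hc, mvfderiv_const] at h1
    simpa using h1
  · rintro ⟨φ, hφ, rfl⟩
    refine ⟨contMDiff_const, fun p v => ?_⟩
    rw [spinDeriv_canonicalConnection h, mvfderiv_const]
    have := (isInvariantSpinor_iff h ρ φ).1
      ((hg.isG2Spinor_of_fixed (vol_gen hρ) hφ).isInvariantSpinor hg)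
    simp [this]

/-! ### Clifford products with tangent vectors and the Killing equation -/

theorem cliffVec_eq (lam : ℝ) (p : N1) (v : T p) :
    cliffVec lam p v = ∑ a, coframe lam a p v • gen a := by
  have h : (fun a => coframe lam a p v) = ∑ a, coframe lam a p v • (Pi.single a 1 : Idx → ℝ) := by
    ext b
    simp [Finset.sum_apply, Pi.single_apply]
  rw [cliffVec, h, map_sum]
  simp only [map_smul, gen]

theorem coframe_of_mem_vertical {lam : ℝ} (h : 0 < lam) {p : N1} {v : T p}
    (hv : v ∈ vertical lam p) (a : Fin 4) : coframe lam (.inr a) p v = 0 := by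
  induction hv using Submodule.span_induction with
  | mem x hx =>
    obtain ⟨i, rfl⟩ := hx
    simp [coframe_frame h]
  | zero => exact map_zero _
  | add x y _ _ hx hy => rw [map_add, hx, hy, add_zero]
  | smul c x _ hx => rw [map_smul, hx, smul_zero]

theorem coframe_of_mem_horizontal {lam : ℝ} {p : N1} {v : T p}
    (hv : v ∈ horizontal lam p) (i : Fin 3) : coframe lam (.inl i) p v = 0 :=
  hv _ (Submodule.subset_span ⟨i, rfl⟩)

/-- The Killing numbers of the parallel spinor. -/
def killingNumber (lam : ℝ) (a : Idx) : ℝ :=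
  Sum.elim (fun _ => lam / 2) (fun _ => -(3 * lam / 4)) a

/-- The eigenvalues of the torsion form on Clifford products with the parallel spinor. -/
def torsionNumber (lam : ℝ) (a : Idx) : ℝ := Sum.elim (fun _ => 6 * lam) (fun _ => -4 * lam) a

theorem map_cliffTorsion {lam : ℝ} (h : 0 < lam) (ρ : Cl →ₐ[ℝ] Module.End ℝ Δ) (p : N1) :
    ρ (cliffTorsion lam p) = torsionEnd lam fun a => ρ (gen a) := by
  rw [cliffTorsion_eq h]
  simp only [torsionEnd, map_smul, map_add, map_mul]

theorem torsion_mul_cliffVec {lam : ℝ} (h : 0 < lam) {ρ : Cl →ₐ[ℝ] Module.End ℝ Δ} {φ : Δ}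
    (hφ : IsG2Spinor (fun a => ρ (gen a)) φ) (p : N1) (v : T p) :
    ρ (cliffTorsion lam p * cliffVec lam p v) φ =
      ∑ a, (coframe lam a p v * torsionNumber lam a) • ρ (gen a) φ := by
  have hg := isCliffordFrame_gen ρ
  rw [map_mul, map_cliffTorsion h, cliffVec_eq, map_sum, Module.End.mul_apply, LinearMap.sum_apply,
    map_sum]
  refine Finset.sum_congr rfl fun a _ => ?_
  rw [map_smul, LinearMap.smul_apply, map_smul, mul_smul]
  congr 1
  rcases a with i | a
  · exact hφ.torsionEnd_inl hg lam i
  · exact hφ.torsionEnd_inr hg lam a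

theorem spinDeriv_leviCivita_const {lam : ℝ} (h : 0 < lam) {ρ : Cl →ₐ[ℝ] Module.End ℝ Δ} {φ : Δ}
    (hφ : IsG2Spinor (fun a => ρ (gen a)) φ) (p : N1) (v : T p) :
    spinDeriv lam ρ (leviCivita lam) (fun _ => φ) p v =
      ∑ a, (coframe lam a p v * killingNumber lam a) • ρ (gen a) φ := by
  have hg := isCliffordFrame_gen ρ
  rw [spinDeriv_leviCivita h, mvfderiv_const, _root_.zero_apply, zero_add]
  refine Finset.sum_congr rfl fun a _ => ?_
  rw [mul_smul]
  congr 1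
  rcases a with i | a
  · refine Eq.trans ?_ (hφ.leviCivita_inl hg lam i)
    rw [spinForm_leviCivita_inl]
    fin_cases i <;> simp
  · refine Eq.trans ?_ (hφ.leviCivita_inr hg lam a)
    rw [spinForm_leviCivita_inr]
    simp

theorem map_cliffVec_apply (lam : ℝ) (ρ : Cl →ₐ[ℝ] Module.End ℝ Δ) (φ : Δ) (p : N1) (v : T p) :
    ρ (cliffVec lam p v) φ = ∑ a, coframe lam a p v • ρ (gen a) φ := by
  simp only [cliffVec_eq, map_sum, map_smul, LinearMap.sum_apply, LinearMap.smul_apply]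

/-- A weighted Clifford product, for a vector on which the weights are constant. -/
theorem sum_weighted (lam : ℝ) (ρ : Cl →ₐ[ℝ] Module.End ℝ Δ) (φ : Δ) (p : N1) (v : T p)
    {w : Idx → ℝ} {c : ℝ} (hw : ∀ a, coframe lam a p v = 0 ∨ w a = c) :
    ∑ a, (coframe lam a p v * w a) • ρ (gen a) φ = c • ρ (cliffVec lam p v) φ := by
  rw [map_cliffVec_apply, Finset.smul_sum]
  refine Finset.sum_congr rfl fun a _ => ?_
  rcases hw a with h | h
  · simp [h]
  · rw [h, mul_comm, mul_smul]

/-- The field of symmetric endomorphisms of the generalized Killing equation. -/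
def killingEnd (lam : ℝ) (p : N1) : T p →L[ℝ] T p :=
  ∑ a, killingNumber lam a • (coframe lam a p).smulRight (frame lam a p)

theorem coframe_killingEnd {lam : ℝ} (h : 0 < lam) (p : N1) (v : T p) (a : Idx) :
    coframe lam a p (killingEnd lam p v) = coframe lam a p v * killingNumber lam a := by
  simp only [killingEnd, _root_.sum_apply, _root_.smul_apply, ContinuousLinearMap.smulRight_apply,
    map_sum, map_smul, coframe_frame h]
  simp [mul_comm]

/-- The manifold is a vector space with its standard chart, so smoothness of a section is smoothness
of its vector-valued component. -/
theorem contMDiff_section_iff {X : Π p : N1, T p} :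
    ContMDiff 𝓘(ℝ, E) 𝓘(ℝ, E).tangent ∞ (fun p => (⟨p, X p⟩ : TangentBundle 𝓘(ℝ, E) N1)) ↔
      ContDiff ℝ ∞ (fun p : E => (X p : E)) :=
  contMDiff_vectorSpace_iff_contDiff (E := E)

theorem contDiff_leftCLM {k : E → E} {Y : E → E} (hk : ContDiff ℝ ∞ k) (hY : ContDiff ℝ ∞ Y) :
    ContDiff ℝ ∞ fun q => leftCLM (k q) (Y q) := by
  refine contDiff_pi.2 fun a => ?_
  rcases a with i | i <;> fin_cases i <;> simp [leftCLM, bracket] <;> fun_prop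

theorem killingEnd_apply {lam : ℝ} (h : 0 < lam) (p : N1) (v : T p) :
    killingEnd lam p v = ∑ a,
      (killingNumber lam a * (Sum.elim (fun _ => lam) (fun _ => 1) a * maurerCartan p v a)) •
        frame lam a p := by
  simp only [killingEnd, _root_.sum_apply, _root_.smul_apply, ContinuousLinearMap.smulRight_apply,
    coframe_apply h, mul_smul]

theorem contDiff_killingEnd {lam : ℝ} (h : 0 < lam) {X : Π p : N1, T p}
    (hX : ContDiff ℝ ∞ (fun p : E => (X p : E))) :
    ContDiff ℝ ∞ (fun p : E => (killingEnd lam p (X p) : E)) := by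
  have e : (fun p : E => (killingEnd lam p (X p) : E)) = fun p : E => ∑ a,
      (killingNumber lam a * (Sum.elim (fun _ => lam) (fun _ => 1) a * leftCLM (-p) (X p) a)) •
        leftCLM p (frameOne lam a) := by
    refine funext fun p : N1 => ?_
    rw [killingEnd_apply h]
    simp only [frame_eq, maurerCartan_eq]
    rfl
  rw [e]
  refine ContDiff.sum fun a _ => ContDiff.smul
    (f := fun p : E => killingNumber lam a *
      (Sum.elim (fun _ => lam) (fun _ => 1) a * leftCLM (-p) (X p) a))
    ?_ (contDiff_leftCLM contDiff_id contDiff_const)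
  exact contDiff_const.mul (contDiff_const.mul (contDiff_pi.1 (contDiff_leftCLM contDiff_neg hX) a))

theorem isGeneralizedKillingSpinor_const {lam : ℝ} (h : 0 < lam) {ρ : Cl →ₐ[ℝ] Module.End ℝ Δ}
    {φ : Δ} (h0 : φ ≠ 0) (hφ : IsG2Spinor (fun a => ρ (gen a)) φ) :
    IsGeneralizedKillingSpinor lam ρ fun _ => φ := by
  refine ⟨contMDiff_const, fun h1 => h0 (congrFun h1 1), killingEnd lam, fun X hX => ?_,
    fun p v w => ?_, fun p v => ?_⟩
  · exact contMDiff_section_iff.2 (contDiff_killingEnd h (contMDiff_section_iff.1 hX))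
  · rw [metric_eq_sum h, metric_eq_sum h]
    refine Finset.sum_congr rfl fun a _ => ?_
    rw [coframe_killingEnd h, coframe_killingEnd h]
    ring
  · rw [spinDeriv_leviCivita_const h hφ, map_cliffVec_apply]
    simp only [coframe_killingEnd h]

end Parallel

end QHeis

end

open QHeis in
theorem corollary2p7 (lam : ℝ) (hlam : 0 < lam)
    {Δ : Type*} [NormedAddCommGroup Δ] [NormedSpace ℝ Δ] (hΔ : Module.finrank ℝ Δ = 8)
    (ρ : Cl →ₐ[ℝ] Module.End ℝ Δ) (hρ : ρ volumeElement = 1) :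
    (∃ ψ₀ : N1 → Δ, IsParallelSpinor lam ρ ψ₀ ∧ (∀ p, ψ₀ p ≠ 0) ∧
      ∀ ψ, IsParallelSpinor lam ρ ψ → ∃ c : ℝ, ψ = c • ψ₀) ∧
    ∀ ψ₀ : N1 → Δ, IsParallelSpinor lam ρ ψ₀ → ψ₀ ≠ 0 →
      (∀ p, ρ (cliffTorsion lam p) (ψ₀ p) = (-2 * lam) • ψ₀ p) ∧
      (∀ p, ∀ X ∈ vertical lam p,
        ρ (cliffTorsion lam p * cliffVec lam p X) (ψ₀ p) =
          (6 * lam) • ρ (cliffVec lam p X) (ψ₀ p)) ∧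
      (∀ p, ∀ X ∈ horizontal lam p,
        ρ (cliffTorsion lam p * cliffVec lam p X) (ψ₀ p) =
          (-4 * lam) • ρ (cliffVec lam p X) (ψ₀ p)) ∧
      IsGeneralizedKillingSpinor lam ρ ψ₀ ∧
      (∀ p, ∀ X ∈ vertical lam p,
        spinDeriv lam ρ (leviCivita lam) ψ₀ p X =
          (lam / 2) • ρ (cliffVec lam p X) (ψ₀ p)) ∧
      (∀ p, ∀ X ∈ horizontal lam p,
        spinDeriv lam ρ (leviCivita lam) ψ₀ p X =
          (-(3 * lam / 4)) • ρ (cliffVec lam p X) (ψ₀ p)) := by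
  have hg := isCliffordFrame_gen ρ
  have hG2 : ∀ {φ}, φ ∈ IsCliffordFrame.fixedSpinors (fun a => ρ (gen a)) →
      IsCliffordFrame.IsG2Spinor (fun a => ρ (gen a)) φ :=
    hg.isG2Spinor_of_fixed (vol_gen hρ)
  constructor
  · obtain ⟨φ, hφ, hspan⟩ := finrank_eq_one_iff'.1 (hg.finrank_fixedSpinors hΔ)
    have hφ0 : (φ : Δ) ≠ 0 := fun h => hφ (Subtype.ext h)
    refine ⟨fun _ => φ, (isParallelSpinor_iff hlam hρ).2 ⟨φ, φ.2, rfl⟩, fun _ => hφ0, ?_⟩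
    intro ψ hψ
    obtain ⟨χ, hχ, rfl⟩ := (isParallelSpinor_iff hlam hρ).1 hψ
    obtain ⟨c, hc⟩ := hspan ⟨χ, hχ⟩
    exact ⟨c, funext fun _ => (congrArg Subtype.val hc).symm⟩
  · intro ψ₀ hψ hne
    obtain ⟨φ, hφ, rfl⟩ := (isParallelSpinor_iff hlam hρ).1 hψ
    have h2 := hG2 hφ
    have hφ0 : φ ≠ 0 := fun h => hne (by rw [h]; rfl)
    refine ⟨fun p => ?_, fun p X hX => ?_, fun p X hX => ?_,
      isGeneralizedKillingSpinor_const hlam hφ0 h2, fun p X hX => ?_, fun p X hX => ?_⟩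
    · rw [map_cliffTorsion hlam]
      exact h2.torsionEnd_apply hg lam
    · rw [torsion_mul_cliffVec hlam h2]
      -- For vertical `X` the weight is constant on the vertical indices and the horizontal
      -- coordinates vanish; in the horizontal cases these roles are exchanged.
      refine sum_weighted lam ρ φ p X (Sum.forall.2 ⟨fun _ => .inr rfl, fun a => .inl ?_⟩)
      exact coframe_of_mem_vertical hlam hX a
    · rw [torsion_mul_cliffVec hlam h2]
      refine sum_weighted lam ρ φ p X (Sum.forall.2 ⟨fun i => .inl ?_, fun _ => .inr rfl⟩)
      exact coframe_of_mem_horizontal hX i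
    · rw [spinDeriv_leviCivita_const hlam h2]
      refine sum_weighted lam ρ φ p X (Sum.forall.2 ⟨fun _ => .inr rfl, fun a => .inl ?_⟩)
      exact coframe_of_mem_vertical hlam hX a
    · rw [spinDeriv_leviCivita_const hlam h2]
      refine sum_weighted lam ρ φ p X (Sum.forall.2 ⟨fun i => .inl ?_, fun _ => .inr rfl⟩)
      exact coframe_of_mem_horizontal hX i
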